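/- **Theorem 6.1 (abstract constructive Krein–Rutman–Doblin–Harris theorem).** Let $X$, $Y$ be real Banach lattices and $\langle\cdot,\cdot\rangle : Y\times X\to\mathbb R$ a continuous bilinear bracket such that $f\ge 0$ iff $\langle\psi,f\rangle\ge0$ for all $\psi\in Y_+$, and $\phi\ge0$ iff $\langle\phi,g\rangle\ge 0$ for all $g\in X_+$. Let $S=(S_t)_{t\ge0}$ be a positive strongly continuous semigroup on $X$ with generator $\mathcal L$ and $S^*=(S^*_t)_{t\ge0}$ a strongly continuous semigroup on $Y$ with generator $\mathcal L^*$ such that $\langle\phi,S_tf\rangle=\langle S_t^*\phi,f\rangle$ for all $f\in X$, $\phi\in Y$, $t\ge0$. For $\psi\in Y_+$, $g\in X_+$ put $[f]_\psi:=\langle\psi,|f|\rangle$ and $[\phi]_g:=\langle|\phi|,g\rangle$. Let $\|\cdot\|_0,\|\cdot\|_1$ be lattice norms on $X$ and on $Y$ (that is, $|x|\le|y|$ implies $\|x\|_k\le\|y\|_k$) with $$\|f\|_0\le\|f\|_1,\quad \|\phi\|_0\le\|\phi\|_1,\quad |\langle\phi,f\rangle|\le\|\phi\|_0\|f\|_1,\quad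 |\langle\phi,f\rangle|\le\|\phi\|_1\|f\|_0 .$$ Let $\lambda<\lambda_0$ and $\lambda'$ be real numbers, $C_0,C_1>0$, $C_0'\ge1$, $0\le T_0<T_1$, let $\eta_{\varepsilon,T}>0$ for $\varepsilon>0$, $T\ge T_1$, and let $\xi_\varepsilon,\Xi_\varepsilon>0$ for $\varepsilon\in(0,1]$ with $\xi_\varepsilon\searrow0$ and $\Xi_\varepsilon\nearrow\infty$ as $\varepsilon\searrow0$. Assume the following. 1. (Primal dissipativity) For $k=0,1$, all $f\in X$ and $t>0$, $$\|S_tf\|_k\le C_0e^{\lambda t}\|f\|_k+C_1\int_0^te^{\lambda(t-s)}\|S_sf\|_0\,ds .$$ 2. (Dual dissipativity) There are families of linear maps $V(t),W(t):Y\to Y$, $t>0$, with $$S^*_t\phi=V(t)\phi+\int_0^tW(t-s)S^*_s\phi\,ds$$ (the integrand being Bochner integrable in $Y$), $\|V(t)\phi\|_0\le C_0e^{\lambda t}\|\phi\|_0$, $\|W(t)\phi\|_1\le C_1e^{\lambda t}\|\phi\|_0$, and $W(t)\phi\ge0$ for $\phi\ge0$. 3. (Supereigenvector) There is $t_0>0$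 such that either $S_{t_0}f_0\ge e^{\lambda_0t_0}f_0$ for some $f_0\in X_+\setminus\{0\}$, or $S^*_{t_0}\phi_0\ge e^{\lambda_0t_0}\phi_0$ for some $\phi_0\in Y_+\setminus\{0\}$. 4. (Relaxed Doblin–Harris positivity) There are bounded families $(g_\varepsilon)_{\varepsilon>0}$ in $X_+$ and $(\psi_\varepsilon)_{\varepsilon>0}$ in $Y_+$, decreasing in $\varepsilon$, such that for all $\varepsilon>0$ and $T\ge T_1$ $$S_Tf\ge\eta_{\varepsilon,T}\,[S_{T_0}f]_{\psi_\varepsilon}\,g_\varepsilon\quad(f\in X_+),\qquad S^*_T\phi\ge\eta_{\varepsilon,T}\,[S^*_{T_0}\phi]_{g_\varepsilon}\,\psi_\varepsilon\quad(\phi\in Y_+).$$ 5. (Interpolation) For all $\varepsilon\in(0,1]$, $f\in X$, $\phi\in Y$, $$\|f\|_0\le\xi_\varepsilon\|f\|_1+\Xi_\varepsilon[f]_{\psi_\varepsilon},\qquad \|\phi\|_0\le\xi_\varepsilon\|\phi\|_1+\Xi_\varepsilon[\phi]_{g_\varepsilon}.$$ 6. $(X,\|\cdot\|_1)$ is complete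 and $\|S_tf\|_1\le C_0'e^{\lambda't}\|f\|_1$ for all $f\in X$, $t\ge0$. 7. Every $\|\cdot\|_1$-bounded sequence of $Y$ has a subsequence converging to an element of $Y$ in the weak topology $\sigma(Y,X)$. Then there is a unique triplet $(\lambda_1,f_1,\phi_1)\in\mathbb R\times X\times Y$ with $f_1\in D(\mathcal L)$, $\phi_1\in D(\mathcal L^*)$ and $$\mathcal Lf_1=\lambda_1f_1,\quad f_1\ge0,\quad \mathcal L^*\phi_1=\lambda_1\phi_1,\quad\phi_1\ge0,\quad\|\phi_1\|_0=1,\quad\langle\phi_1,f_1\rangle=1 .$$ Furthermore, there are constants $C\ge1$ and $\lambda_2<\lambda_1$ such that for all $f\in X$ and $t\ge0$ $$\|S_tf-\langle\phi_1,f\rangle f_1e^{\lambda_1t}\|_1\le Ce^{\lambda_2t}\,\|f-\langle\phi_1,f\rangle f_1\|_1 ,$$ where $C$ and the gap $\lambda_1-\lambda_2>0$ depend only on $\lambda,\lambda_0,\lambda',C_0,C_1,C_0',T_0,T_1$ and the functions $\eta,\xi,\Xi$, and not otherwise on the spaces, the norms or the semigroups. -/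

import Mathlib

universe u v

namespace KreinRutman

open Filter Topology Set

/-- A strongly continuous semigroup `(S t)_{t ≥ 0}` of bounded operators on a Banach space `E`.
Only the values at `t ≥ 0` matter. -/
structure C0Semigroup (E : Type*) [NormedAddCommGroup E] [NormedSpace ℝ E] where
  op : ℝ → E →L[ℝ] E
  op_zero : op 0 = ContinuousLinearMap.id ℝ E
  op_add : ∀ s t : ℝ, 0 ≤ s → 0 ≤ t → op (s + t) = (op s).comp (op t)
  continuous_orbit : ∀ x : E, ContinuousOn (fun t => op t x) (Ici 0)

namespace C0Semigroup

variable {E : Type*} [NormedAddCommGroup E] [NormedSpace ℝ E]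

/-- `x` belongs to the domain of the infinitesimal generator of `S`, and the generator maps
`x` to `y`. -/
def GeneratorMaps (S : C0Semigroup E) (x y : E) : Prop :=
  Tendsto (fun t : ℝ => t⁻¹ • (S.op t x - x)) (𝓝[>] 0) (𝓝 y)

/-- Every `S t`, `t ≥ 0`, preserves the positive cone. -/
def IsPositive [PartialOrder E] (S : C0Semigroup E) : Prop :=
  ∀ t : ℝ, 0 ≤ t → ∀ x : E, 0 ≤ x → 0 ≤ S.op t x

end C0Semigroup

/-- A lattice norm on a vector lattice `E`, not necessarily complete and not necessarily
equivalent to a given norm of `E`. -/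
structure LatticeNorm (E : Type*) [AddCommGroup E] [Module ℝ E] [Lattice E] where
  toSeminorm : Seminorm ℝ E
  eq_zero_of : ∀ x : E, toSeminorm x = 0 → x = 0
  solid : ∀ x y : E, |x| ≤ |y| → toSeminorm x ≤ toSeminorm y

namespace LatticeNorm

variable {E : Type*} [AddCommGroup E] [Module ℝ E] [Lattice E]

instance : CoeFun (LatticeNorm E) (fun _ => E → ℝ) := ⟨fun N => N.toSeminorm⟩

/-- `E` endowed with the norm `N` is a Banach space. -/
def IsBanach (N : LatticeNorm E) : Prop :=
  ∀ u : ℕ → E,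
    (∀ e : ℝ, 0 < e → ∃ n₀ : ℕ, ∀ m n : ℕ, n₀ ≤ m → n₀ ≤ n → N (u m - u n) < e) →
    ∃ x : E, Tendsto (fun n => N (u n - x)) atTop (𝓝 0)

end LatticeNorm

section

variable {X Y : Type*}
  [NormedAddCommGroup X] [Lattice X] [NormedSpace ℝ X]
  [NormedAddCommGroup Y] [Lattice Y] [NormedSpace ℝ Y]

/-- The seminorm `[f]_ψ = ⟨ψ, |f|⟩` on `X`. -/
noncomputable def bracketX (B : Y →L[ℝ] X →L[ℝ] ℝ) (ψ : Y) (f : X) : ℝ := B ψ |f|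

/-- The seminorm `[φ]_g = ⟨|φ|, g⟩` on `Y`. -/
noncomputable def bracketY (B : Y →L[ℝ] X →L[ℝ] ℝ) (g : X) (φ : Y) : ℝ := B |φ| g

/-- The bracket `B φ f = ⟨φ, f⟩` puts the ordered spaces `Y` and `X` in duality: each positive
cone is the dual cone of the other one (in particular the bracket separates the points of both
spaces, so that it embeds `Y` in `X'` and `X` in `Y'`). -/
structure OrderDuality (B : Y →L[ℝ] X →L[ℝ] ℝ) : Prop where
  nonneg_left : ∀ φ : Y, 0 ≤ φ ↔ ∀ g : X, 0 ≤ g → 0 ≤ B φ g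
  nonneg_right : ∀ f : X, 0 ≤ f ↔ ∀ ψ : Y, 0 ≤ ψ → 0 ≤ B ψ f

/-- The semigroup `Sd` on `Y` is dual to the semigroup `S` on `X`. -/
def DualSemigroups (B : Y →L[ℝ] X →L[ℝ] ℝ) (S : C0Semigroup X) (Sd : C0Semigroup Y) : Prop :=
  ∀ t : ℝ, 0 ≤ t → ∀ (φ : Y) (f : X), B φ (S.op t f) = B (Sd.op t φ) f

/-- Compatibility between the norms `‖·‖₀, ‖·‖₁` on `X` and on `Y` and the bracket. -/
structure CompatibleNorms (B : Y →L[ℝ] X →L[ℝ] ℝ)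
    (NX : Fin 2 → LatticeNorm X) (NY : Fin 2 → LatticeNorm Y) : Prop where
  le_X : ∀ f : X, NX 0 f ≤ NX 1 f
  le_Y : ∀ φ : Y, NY 0 φ ≤ NY 1 φ
  pairing_01 : ∀ (φ : Y) (f : X), |B φ f| ≤ NY 0 φ * NX 1 f
  pairing_10 : ∀ (φ : Y) (f : X), |B φ f| ≤ NY 1 φ * NX 0 f

/-- Strong dissipativity of the primal semigroup, for both norms. -/
def StronglyDissipative (lam C₀ C₁ : ℝ) (S : C0Semigroup X) (NX : Fin 2 → LatticeNorm X) : Prop :=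
  ∀ (k : Fin 2) (f : X) (t : ℝ), 0 < t →
    NX k (S.op t f) ≤ C₀ * Real.exp (lam * t) * NX k f
      + C₁ * ∫ s in (0 : ℝ)..t, Real.exp (lam * (t - s)) * NX 0 (S.op s f)

/-- Strong dissipativity of the dual semigroup, through a splitting `S* = V + W * S*`, where
`(W * S*)(t) = ∫₀ᵗ W(t - s) S*(s) ds`. -/
def DualSplitting (lam C₀ C₁ : ℝ) (Sd : C0Semigroup Y) (NY : Fin 2 → LatticeNorm Y) : Prop :=
  ∃ V W : ℝ → Y →ₗ[ℝ] Y,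
    (∀ (t : ℝ) (φ : Y), 0 < t →
      IntervalIntegrable (fun s => W (t - s) (Sd.op s φ)) MeasureTheory.volume 0 t ∧
      Sd.op t φ = V t φ + ∫ s in (0 : ℝ)..t, W (t - s) (Sd.op s φ)) ∧
    (∀ (t : ℝ) (φ : Y), 0 < t → NY 0 (V t φ) ≤ C₀ * Real.exp (lam * t) * NY 0 φ) ∧
    (∀ (t : ℝ) (φ : Y), 0 < t → NY 1 (W t φ) ≤ C₁ * Real.exp (lam * t) * NY 0 φ) ∧
    (∀ (t : ℝ) (φ : Y), 0 < t → 0 ≤ φ → 0 ≤ W t φ)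

/-- There is a nonzero nonnegative `x` with `S(t₀) x ≥ e^{lam₀ t₀} x` for some `t₀ > 0`. -/
def HasSupereigenvector {E : Type*} [NormedAddCommGroup E] [Lattice E] [NormedSpace ℝ E]
    (lam₀ : ℝ) (S : C0Semigroup E) : Prop :=
  ∃ t₀ : ℝ, 0 < t₀ ∧ ∃ x : E, 0 ≤ x ∧ x ≠ 0 ∧ Real.exp (lam₀ * t₀) • x ≤ S.op t₀ x

/-- A bounded family of nonnegative elements, indexed by `ε > 0` and decreasing in `ε`. -/
structure BoundedDecreasingFamily {E : Type*} [NormedAddCommGroup E] [Lattice E]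
    (g : ℝ → E) : Prop where
  nonneg : ∀ ε : ℝ, 0 < ε → 0 ≤ g ε
  antitone : AntitoneOn g (Ioi 0)
  bounded : ∃ M : ℝ, ∀ ε : ℝ, 0 < ε → ‖g ε‖ ≤ M

/-- The relaxed Doblin–Harris positivity conditions, primal and dual. -/
structure DoblinHarris (T₀ T₁ : ℝ) (η : ℝ → ℝ → ℝ) (B : Y →L[ℝ] X →L[ℝ] ℝ)
    (S : C0Semigroup X) (Sd : C0Semigroup Y) (g : ℝ → X) (ψ : ℝ → Y) : Prop where
  primal : ∀ (ε T : ℝ), 0 < ε → T₁ ≤ T → ∀ f : X, 0 ≤ f →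
    (η ε T * bracketX B (ψ ε) (S.op T₀ f)) • g ε ≤ S.op T f
  dual : ∀ (ε T : ℝ), 0 < ε → T₁ ≤ T → ∀ φ : Y, 0 ≤ φ →
    (η ε T * bracketY B (g ε) (Sd.op T₀ φ)) • ψ ε ≤ Sd.op T φ

/-- The interpolation conditions between the norms and the seminorms, primal and dual. -/
structure Interpolation (ξ Ξ : ℝ → ℝ) (B : Y →L[ℝ] X →L[ℝ] ℝ)
    (NX : Fin 2 → LatticeNorm X) (NY : Fin 2 → LatticeNorm Y) (g : ℝ → X) (ψ : ℝ → Y) : Prop where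
  primal : ∀ (ε : ℝ), ε ∈ Ioc (0 : ℝ) 1 → ∀ f : X,
    NX 0 f ≤ ξ ε * NX 1 f + Ξ ε * bracketX B (ψ ε) f
  dual : ∀ (ε : ℝ), ε ∈ Ioc (0 : ℝ) 1 → ∀ φ : Y,
    NY 0 φ ≤ ξ ε * NY 1 φ + Ξ ε * bracketY B (g ε) φ

/-- Exponential growth bound of the semigroup for the norm `N`. -/
def GrowthBound (lam' C₀' : ℝ) (S : C0Semigroup X) (N : LatticeNorm X) : Prop :=
  ∀ (f : X) (t : ℝ), 0 ≤ t → N (S.op t f) ≤ C₀' * Real.exp (lam' * t) * N f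

/-- Every sequence of `Y` that is bounded for the norm `N` has a subsequence that converges in
`Y` for the weak topology `σ(Y, X)`. -/
def WeaklySeqCompactBalls (B : Y →L[ℝ] X →L[ℝ] ℝ) (N : LatticeNorm Y) : Prop :=
  ∀ (u : ℕ → Y) (M : ℝ), (∀ n, N (u n) ≤ M) →
    ∃ (φ : Y) (σ : ℕ → ℕ), StrictMono σ ∧
      ∀ f : X, Tendsto (fun n => B (u (σ n)) f) atTop (𝓝 (B φ f))

/-- `(lam₁, f₁, φ₁)` is a nonnegative eigentriplet for the generators of `S` and `Sd`, normalized
by `‖φ₁‖₀ = 1` and `⟨φ₁, f₁⟩ = 1`. -/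
structure IsEigentriplet (B : Y →L[ℝ] X →L[ℝ] ℝ) (S : C0Semigroup X) (Sd : C0Semigroup Y)
    (N₀ : LatticeNorm Y) (lam₁ : ℝ) (f₁ : X) (φ₁ : Y) : Prop where
  primal : S.GeneratorMaps f₁ (lam₁ • f₁)
  primal_nonneg : 0 ≤ f₁
  dual : Sd.GeneratorMaps φ₁ (lam₁ • φ₁)
  dual_nonneg : 0 ≤ φ₁
  norm_dual : N₀ φ₁ = 1
  pairing : B φ₁ f₁ = 1

end

end KreinRutman

set_option linter.unusedSectionVars false

/-! The dual eigenvector comes first. Fix `ε₀` with `ξ ε₀` small against the gap `lam₀ - lam`, let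
`g`, `ψ` be the members of the two families at `ε₀`, and let `ω` be the abscissa of convergence of
the Laplace transform of `t ↦ ⟨ψ, S_t g⟩`. Where the transform converges, dissipativity and
interpolation give Volterra inequalities whose kernel has mass at most 1/2, and these force `S*_t =
o(e^{κ t})` on the positive cone (`dualDecay_of_laplace`). Such decay excludes supereigenvectors of
rate `κ` or more, and it self-improves to a slightly smaller rate; hence `ω ≥ lam₀` and the
transform diverges at `ω` (`exists_abscissa`). Because of the divergence, normalized truncated
transforms of `S*_t ψ` are approximate eigenvectors. The splitting bounds them in `‖·‖₁` up to a
small `‖·‖₀` error, weak compactness provides a limit, and interpolation against `g` keeps it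
nonzero (`exists_dual_eigenvector`).

The eigenvector `φ` then allows a Harris argument. The dual Doblin condition dominates `ψ` by a
multiple of `φ`, so interpolation may use `⟨φ, |f|⟩` as weak seminorm; dissipativity becomes a
Lyapunov estimate (`lyapunov_estimate`). On the kernel of `φ`, the primal Doblin condition contracts
`⟨φ, |f|⟩` unless `‖f‖₁` is much larger (`doblin_contraction`), and in that other regime the
Lyapunov estimate contracts `‖f‖₁`. A weighted sum of the two always contracts
(`harris_combination`), whence exponential decay on the kernel (`exp_decay_on_kernel`).

That decay makes `e^{-lam₁ t} S_t h` converge to the primal eigenvector, yields uniqueness, and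
gives the final estimate, as `f - ⟨φ, f⟩ f₁` lies in the kernel. The estimates involve `lam₁` only
through `lam₀ ≤ lam₁ ≤ lam'`, so `C` and the gap can be fixed in advance. -/

namespace KreinRutman

open Filter Topology Set

/-! ### Scalar Volterra inequalities and exponential decay. -/

section Scalar

lemma continuous_expKernel (a t : ℝ) : Continuous fun s : ℝ => Real.exp (-(a * (t - s))) := by
  fun_prop

lemma integral_expKernel {a : ℝ} (ha : 0 < a) (r t : ℝ) :
    ∫ s in r..t, Real.exp (-(a * (t - s))) = (1 - Real.exp (-(a * (t - r)))) / a := by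
  have h : ∀ s ∈ uIcc r t, HasDerivAt (fun s => Real.exp (-(a * (t - s))) / a)
      (Real.exp (-(a * (t - s)))) s := by
    intro s _
    have h1 : HasDerivAt (fun s : ℝ => -(a * (t - s))) a s := by
      have e : (fun s : ℝ => -(a * (t - s))) = fun s => a * (s - t) := by ext; ring
      rw [e]
      simpa using ((hasDerivAt_id' s).sub_const t).const_mul a
    have h2 := (h1.exp).div_const a
    rwa [mul_div_assoc, div_self ha.ne', mul_one] at h2
  rw [intervalIntegral.integral_eq_sub_of_hasDerivAt h
    ((continuous_expKernel a t).intervalIntegrable _ _)]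
  simp [sub_div]

lemma intervalIntegrable_expKernel_mul {a r t : ℝ} (T : ℝ) {u : ℝ → ℝ} (hrt : r ≤ t)
    (hu : ContinuousOn u (Icc r t)) :
    IntervalIntegrable (fun s => Real.exp (-(a * (T - s))) * u s) MeasureTheory.volume r t := by
  apply ContinuousOn.intervalIntegrable
  rw [uIcc_of_le hrt]
  exact (continuous_expKernel a T).continuousOn.mul hu

lemma integral_expKernel_mul_le {a r t m : ℝ} {u : ℝ → ℝ} (ha : 0 < a) (hrt : r ≤ t)
    (hu : ContinuousOn u (Icc r t)) (hm : 0 ≤ m) (hum : ∀ s ∈ Icc r t, u s ≤ m) :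
    ∫ s in r..t, Real.exp (-(a * (t - s))) * u s ≤ m / a := by
  calc ∫ s in r..t, Real.exp (-(a * (t - s))) * u s
      ≤ ∫ s in r..t, Real.exp (-(a * (t - s))) * m := by
        apply intervalIntegral.integral_mono_on hrt (intervalIntegrable_expKernel_mul t hrt hu)
          (intervalIntegrable_expKernel_mul t hrt continuousOn_const)
        intro s hs
        exact mul_le_mul_of_nonneg_left (hum s hs) (Real.exp_pos _).le
    _ = (1 - Real.exp (-(a * (t - r)))) / a * m := by
        rw [intervalIntegral.integral_mul_const, integral_expKernel ha]
    _ ≤ 1 / a * m := by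
        gcongr
        linarith [Real.exp_pos (-(a * (t - r)))]
    _ = m / a := by ring

/-- A Volterra inequality with a small exponential kernel bounds its solutions. -/
lemma volterra_bounded {a c D τ : ℝ} {u : ℝ → ℝ} (ha : 0 < a) (hc : 0 ≤ c) (hca : c ≤ a / 2)
    (hcont : ContinuousOn u (Icc 0 τ)) (hnonneg : ∀ t ∈ Icc 0 τ, 0 ≤ u t) (hzero : u 0 ≤ D)
    (hu : ∀ t ∈ Ioc 0 τ, u t ≤ D + c * ∫ s in (0 : ℝ)..t, Real.exp (-(a * (t - s))) * u s) :
    ∀ t ∈ Icc 0 τ, u t ≤ 2 * D := by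
  intro t ht
  have hτ : 0 ≤ τ := ht.1.trans ht.2
  have hD : 0 ≤ D := (hnonneg 0 ⟨le_rfl, hτ⟩).trans hzero
  -- At a maximum point the inequality reads `u x ≤ D + (c / a) * u x`, and `c / a ≤ 1 / 2` absorbs
  -- the last term.
  obtain ⟨x, hx, hmax⟩ := isCompact_Icc.exists_isMaxOn (nonempty_Icc.2 hτ) hcont
  have hmax' : ∀ s ∈ Icc 0 τ, u s ≤ u x := fun s hs => hmax hs
  refine (hmax' t ht).trans ?_
  rcases hx.1.eq_or_lt with h0 | h0
  · rw [← h0]; linarith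
  · have hx0 := hnonneg x hx
    have h1 := hu x ⟨h0, hx.2⟩
    have hsub : Icc 0 x ⊆ Icc 0 τ := Icc_subset_Icc_right hx.2
    have h2 := integral_expKernel_mul_le ha h0.le (hcont.mono hsub) hx0
      (fun s hs => hmax' s (hsub hs))
    have h3 : c * ∫ s in (0 : ℝ)..x, Real.exp (-(a * (x - s))) * u s ≤ u x / 2 := by
      calc _ ≤ c * (u x / a) := mul_le_mul_of_nonneg_left h2 hc
        _ ≤ (a / 2) * (u x / a) := by gcongr
        _ = u x / 2 := by field_simp
    linarith

lemma tendsto_expKernel (a r : ℝ) (ha : 0 < a) :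
    Tendsto (fun t : ℝ => Real.exp (-(a * (t - r)))) atTop (𝓝 0) := by
  apply Real.tendsto_exp_neg_atTop_nhds_zero.comp
  exact (tendsto_atTop_add_const_right _ (-r) tendsto_id).const_mul_atTop ha

lemma integral_expKernel_mul_eq {a r : ℝ} (t : ℝ) (u : ℝ → ℝ) :
    ∫ s in (0 : ℝ)..r, Real.exp (-(a * (t - s))) * u s
      = Real.exp (-(a * (t - r))) * ∫ s in (0 : ℝ)..r, Real.exp (-(a * (r - s))) * u s := by
  rw [← intervalIntegral.integral_const_mul]
  congr 1; ext s
  rw [← mul_assoc, ← Real.exp_add]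
  congr 2; ring

/-- The history before time `r` enters the convolution only through the damping factor `e^{-a(t -
r)}`. -/
lemma integral_expKernel_mul_split {a r t : ℝ} {u : ℝ → ℝ} (hr : 0 ≤ r) (hrt : r ≤ t)
    (hcont : ContinuousOn u (Ici 0)) :
    ∫ s in (0 : ℝ)..t, Real.exp (-(a * (t - s))) * u s
      = Real.exp (-(a * (t - r))) * (∫ s in (0 : ℝ)..r, Real.exp (-(a * (r - s))) * u s)
        + ∫ s in r..t, Real.exp (-(a * (t - s))) * u s := by
  rw [← integral_expKernel_mul_eq, intervalIntegral.integral_add_adjacent_intervals]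
  · exact intervalIntegrable_expKernel_mul t hr (hcont.mono Icc_subset_Ici_self)
  · exact intervalIntegrable_expKernel_mul t hrt (hcont.mono fun s hs => hr.trans hs.1)

/-- Solutions of a Volterra inequality with a small exponential kernel and a forcing term that
tends to zero decay, uniformly. -/
lemma volterra_decay {a c D : ℝ} {β : ℝ → ℝ} {F : Set (ℝ → ℝ)} (ha : 0 < a) (hc : 0 ≤ c)
    (hca : c ≤ a / 2) (hD : 0 < D) (hβD : ∀ t, 0 < t → β t ≤ D) (hβ : Tendsto β atTop (𝓝 0))
    (hcont : ∀ u ∈ F, ContinuousOn u (Ici 0)) (hnonneg : ∀ u ∈ F, ∀ t, 0 ≤ t → 0 ≤ u t)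
    (hzero : ∀ u ∈ F, u 0 ≤ D)
    (hu : ∀ u ∈ F, ∀ t, 0 < t →
      u t ≤ β t + c * ∫ s in (0 : ℝ)..t, Real.exp (-(a * (t - s))) * u s)
    {e : ℝ} (he : 0 < e) : ∃ t₀, 0 ≤ t₀ ∧ ∀ u ∈ F, ∀ t, t₀ ≤ t → u t ≤ e := by
  have hbd : ∀ u ∈ F, ∀ t, 0 ≤ t → u t ≤ 2 * D := by
    intro u huF t ht
    refine volterra_bounded ha hc hca ((hcont u huF).mono Icc_subset_Ici_self)
      (fun s hs => hnonneg u huF s hs.1) (hzero u huF) (fun s hs => ?_) t ⟨ht, le_rfl⟩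
    exact (hu u huF s hs.1).trans (by linarith [hβD s hs.1])
  -- If `x` bounds all solutions from time `r` on, then for late `t` the forcing contributes at most
  -- `x/8`, the history before `r` at most `x/8`, and the rest at most `x/2`: the bound improves by
  -- the factor 3/4. The waiting time depends on `β`, `D` and `r` only, hence is uniform over `F`.
  have key : ∀ k : ℕ, ∃ t₀, 0 ≤ t₀ ∧ ∀ u ∈ F, ∀ t, t₀ ≤ t → u t ≤ 2 * D * (3 / 4) ^ k := by
    intro k
    induction k with
    | zero => exact ⟨0, le_rfl, fun u huF t ht => by simpa using hbd u huF t ht⟩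
    | succ k ih =>
      obtain ⟨r, hr, hur⟩ := ih
      set x := 2 * D * (3 / 4 : ℝ) ^ k with hx
      have hx0 : 0 < x := by positivity
      have h1 : ∀ᶠ t in atTop, β t < x / 8 := hβ.eventually_lt_const (by positivity)
      have h2 : ∀ᶠ t in atTop, Real.exp (-(a * (t - r))) < x / (8 * D) :=
        (tendsto_expKernel a r ha).eventually_lt_const (by positivity)
      obtain ⟨q, hq⟩ := eventually_atTop.1 (h1.and h2)
      refine ⟨max q (r + 1), by positivity, fun u huF t ht => ?_⟩
      obtain ⟨hb, hE⟩ := hq t ((le_max_left _ _).trans ht)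
      have hrt : r ≤ t := by linarith [(le_max_right q (r + 1)).trans ht]
      have ht0 : 0 < t := by linarith [(le_max_right q (r + 1)).trans ht]
      have e1 := hu u huF t ht0
      rw [integral_expKernel_mul_split hr hrt (hcont u huF)] at e1
      have e2 : ∫ s in (0 : ℝ)..r, Real.exp (-(a * (r - s))) * u s ≤ 2 * D / a :=
        integral_expKernel_mul_le ha hr ((hcont u huF).mono Icc_subset_Ici_self) (by positivity)
          (fun s hs => hbd u huF s hs.1)
      have e3 : ∫ s in r..t, Real.exp (-(a * (t - s))) * u s ≤ x / a :=
        integral_expKernel_mul_le ha hrt ((hcont u huF).mono fun s hs => hr.trans hs.1) hx0.le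
          (fun s hs => hur u huF s hs.1)
      have e4 : Real.exp (-(a * (t - r))) *
          (∫ s in (0 : ℝ)..r, Real.exp (-(a * (r - s))) * u s) ≤ x / (8 * D) * (2 * D / a) := by
        calc _ ≤ Real.exp (-(a * (t - r))) * (2 * D / a) := by gcongr
          _ ≤ _ := by gcongr
      have e5 : x / (8 * D) * (2 * D / a) = x / (4 * a) := by field_simp; norm_num
      have e6 : c * (x / (4 * a) + x / a) ≤ (a / 2) * (x / (4 * a) + x / a) := by gcongr
      have e7 : (a / 2) * (x / (4 * a) + x / a) = 5 / 8 * x := by field_simp; norm_num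
      have e8 : 2 * D * (3 / 4 : ℝ) ^ (k + 1) = 3 / 4 * x := by rw [hx, pow_succ]; ring
      rw [e8]
      have e9 := mul_le_mul_of_nonneg_left (add_le_add (e4.trans e5.le) e3) hc
      linarith
  have hlim : Tendsto (fun k : ℕ => 2 * D * (3 / 4 : ℝ) ^ k) atTop (𝓝 0) := by
    simpa using (tendsto_pow_atTop_nhds_zero_of_lt_one (by norm_num : (0 : ℝ) ≤ 3 / 4)
      (by norm_num)).const_mul (2 * D)
  obtain ⟨k, hk⟩ := (hlim.eventually_lt_const he).exists
  obtain ⟨t₀, h0, h⟩ := key k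
  exact ⟨t₀, h0, fun u huF t ht => (h u huF t ht).trans hk.le⟩

lemma integral_expKernel_mul_le_integral {a r t : ℝ} {v : ℝ → ℝ} (ha : 0 < a) (hrt : r ≤ t)
    (hcont : ContinuousOn v (Icc r t)) (hnonneg : ∀ s ∈ Icc r t, 0 ≤ v s) :
    ∫ s in r..t, Real.exp (-(a * (t - s))) * v s ≤ ∫ s in r..t, v s := by
  apply intervalIntegral.integral_mono_on hrt (intervalIntegrable_expKernel_mul t hrt hcont)
    (hcont.intervalIntegrable_of_Icc hrt)
  intro s hs
  have : Real.exp (-(a * (t - s))) ≤ 1 := Real.exp_le_one_iff.2 (by nlinarith [hs.2])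
  exact mul_le_of_le_one_left (hnonneg s hs) this

/-- The integral of `v` beyond a large `r` is small, and what came before `r` is damped by the
kernel. -/
lemma tendsto_integral_expKernel_mul {a J : ℝ} {v : ℝ → ℝ} (ha : 0 < a)
    (hcont : ContinuousOn v (Ici 0)) (hnonneg : ∀ t, 0 ≤ t → 0 ≤ v t)
    (hJ : ∀ τ, 0 ≤ τ → ∫ s in (0 : ℝ)..τ, v s ≤ J) :
    Tendsto (fun t => ∫ s in (0 : ℝ)..t, Real.exp (-(a * (t - s))) * v s) atTop (𝓝 0) := by
  have hint : ∀ r t, 0 ≤ r → r ≤ t → IntervalIntegrable v MeasureTheory.volume r t :=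
    fun r t hr hrt => (hcont.mono fun s hs => hr.trans hs.1).intervalIntegrable_of_Icc hrt
  have hle : ∀ r t, 0 ≤ r → r ≤ t →
      ∫ s in r..t, Real.exp (-(a * (t - s))) * v s ≤ ∫ s in r..t, v s := fun r t hr hrt =>
    integral_expKernel_mul_le_integral ha hrt (hcont.mono fun s hs => hr.trans hs.1)
      fun s hs => hnonneg s (hr.trans hs.1)
  have hpos : ∀ t, 0 ≤ t → 0 ≤ ∫ s in (0 : ℝ)..t, Real.exp (-(a * (t - s))) * v s := by
    intro t ht
    exact intervalIntegral.integral_nonneg ht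
      fun s hs => mul_nonneg (Real.exp_pos _).le (hnonneg s hs.1)
  have hJ0 : 0 ≤ J := by simpa using hJ 0 le_rfl
  set P : Set ℝ := (fun τ => ∫ s in (0 : ℝ)..τ, v s) '' Ici 0
  have hPne : P.Nonempty := ⟨_, 0, self_mem_Ici, rfl⟩
  have hPbd : BddAbove P := ⟨J, by rintro _ ⟨τ, hτ, rfl⟩; exact hJ τ hτ⟩
  rw [Metric.tendsto_atTop]
  intro e he
  obtain ⟨_, ⟨r, hr, rfl⟩, hr'⟩ := exists_lt_of_lt_csSup hPne
    (show sSup P - e / 2 < sSup P by linarith)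
  have h2 : ∀ᶠ t in atTop, Real.exp (-(a * (t - r))) < e / (2 * (J + 1)) :=
    (tendsto_expKernel a r ha).eventually_lt_const (by positivity)
  obtain ⟨q, hq⟩ := eventually_atTop.1 h2
  refine ⟨max q r, fun t ht => ?_⟩
  have hrt : r ≤ t := (le_max_right _ _).trans ht
  have hr0 : (0 : ℝ) ≤ r := hr
  have hqt := hq t ((le_max_left _ _).trans ht)
  rw [Real.dist_eq, sub_zero, abs_of_nonneg (hpos t (hr0.trans hrt)),
    integral_expKernel_mul_split hr0 hrt hcont]
  have h3 : ∫ s in r..t, v s < e / 2 := by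
    have h4 := intervalIntegral.integral_add_adjacent_intervals (hint 0 r le_rfl hr0)
      (hint r t hr0 hrt)
    have h5 : ∫ s in (0 : ℝ)..t, v s ≤ sSup P := le_csSup hPbd ⟨t, hr0.trans hrt, rfl⟩
    have h6 : sSup P - e / 2 < ∫ s in (0 : ℝ)..r, v s := hr'
    linarith
  have h7 : ∫ s in (0 : ℝ)..r, Real.exp (-(a * (r - s))) * v s ≤ J :=
    (hle 0 r le_rfl hr0).trans (hJ r hr0)
  have h8 : Real.exp (-(a * (t - r))) *
      (∫ s in (0 : ℝ)..r, Real.exp (-(a * (r - s))) * v s) ≤ e / (2 * (J + 1)) * J := by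
    calc _ ≤ Real.exp (-(a * (t - r))) * J := by gcongr
      _ ≤ _ := by gcongr
  have h9 : e / (2 * (J + 1)) * J ≤ e / 2 := by
    rw [div_mul_eq_mul_div, div_le_div_iff₀ (by positivity) (by positivity)]
    nlinarith
  linarith [hle r t hr0 hrt]

/-- A quantity that is contracted over each period `T` decays exponentially. -/
lemma exp_decay_of_contraction {T θ D : ℝ} {u : ℝ → ℝ} (hT : 0 < T) (hθ : 0 < θ) (hθ1 : θ < 1)
    (hbd : ∀ r, 0 ≤ r → r ≤ T → u r ≤ D) (hD : 0 ≤ D)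
    (hstep : ∀ t, 0 ≤ t → u (t + T) ≤ θ * u t) :
    ∀ t, 0 ≤ t → u t ≤ D / θ * Real.exp (Real.log θ / T * t) := by
  have h1 : ∀ n : ℕ, ∀ r, 0 ≤ r → r ≤ T → u (r + n * T) ≤ θ ^ n * D := by
    intro n
    induction n with
    | zero => intro r h0 h1; simpa using hbd r h0 h1
    | succ n ih =>
      intro r h0 h1
      have h2 := hstep (r + n * T) (by positivity)
      have h3 := mul_le_mul_of_nonneg_left (ih r h0 h1) hθ.le
      have h4 : r + (n + 1 : ℕ) * T = r + n * T + T := by push_cast; ring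
      rw [h4, pow_succ]
      linarith
  intro t ht
  set n := ⌊t / T⌋₊
  have hn1 : (n : ℝ) ≤ t / T := Nat.floor_le (by positivity)
  have hn2 : t / T < n + 1 := Nat.lt_floor_add_one _
  have hn1' : n * T ≤ t := by rwa [le_div_iff₀ hT] at hn1
  have hn2' : t < (n + 1) * T := by rwa [div_lt_iff₀ hT] at hn2
  have h2 := h1 n (t - n * T) (by linarith) (by linarith)
  rw [sub_add_cancel] at h2
  refine h2.trans ?_
  have hlog : Real.log θ < 0 := Real.log_neg hθ hθ1
  -- Only `n + 1`, not `n`, exceeds `t / T`; the missing power is the origin of the factor `1 / θ`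
  -- in the bound.
  have h3 : θ ^ (n + 1) ≤ Real.exp (Real.log θ / T * t) := by
    rw [← Real.exp_log (pow_pos hθ (n + 1)), Real.log_pow, Real.exp_le_exp]
    push_cast
    rw [div_mul_eq_mul_div, mul_div_assoc]
    nlinarith
  calc θ ^ n * D = D / θ * θ ^ (n + 1) := by rw [pow_succ]; field_simp
    _ ≤ _ := by gcongr

lemma integral_le_of_le_exp {b A τ : ℝ} {v : ℝ → ℝ} (hb : 0 < b) (hA : 0 ≤ A) (hτ : 0 ≤ τ)
    (hcont : ContinuousOn v (Icc 0 τ)) (hv : ∀ t ∈ Icc 0 τ, v t ≤ A * Real.exp (-(b * t))) :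
    ∫ s in (0 : ℝ)..τ, v s ≤ A / b := by
  have h1 : ∫ s in (0 : ℝ)..τ, Real.exp (-(b * s)) = (1 - Real.exp (-(b * τ))) / b := by
    have := intervalIntegral.integral_comp_sub_left (a := 0) (b := τ)
      (fun s => Real.exp (-(b * s))) τ
    simp only [sub_self, sub_zero] at this
    rw [← this, integral_expKernel hb, sub_zero]
  calc ∫ s in (0 : ℝ)..τ, v s ≤ ∫ s in (0 : ℝ)..τ, A * Real.exp (-(b * s)) := by
        apply intervalIntegral.integral_mono_on hτ (hcont.intervalIntegrable_of_Icc hτ) _ hv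
        exact Continuous.intervalIntegrable (by fun_prop) _ _
    _ = A * ((1 - Real.exp (-(b * τ))) / b) := by
        rw [intervalIntegral.integral_const_mul, h1]
    _ ≤ A * (1 / b) := by
        gcongr
        linarith [Real.exp_pos (-(b * τ))]
    _ = A / b := by ring

/-- Multiplying by `e^{-κ t}` turns a kernel of rate `lam` into a decaying one of rate `κ - lam`,
the form needed by the Volterra lemmas. -/
lemma exp_mul_integral_rescale (lam κ t : ℝ) (n : ℝ → ℝ) :
    Real.exp (-(κ * t)) * ∫ s in (0 : ℝ)..t, Real.exp (lam * (t - s)) * n s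
      = ∫ s in (0 : ℝ)..t, Real.exp (-((κ - lam) * (t - s))) * (Real.exp (-(κ * s)) * n s) := by
  rw [← intervalIntegral.integral_const_mul]
  congr 1; ext s
  rw [← mul_assoc, ← mul_assoc, ← Real.exp_add, ← Real.exp_add]
  congr 2; ring

end Scalar

/-! ### Continuous seminorms of vector-valued integrals. -/

section SeminormIntegral

variable {E : Type*} [NormedAddCommGroup E] [NormedSpace ℝ E]

/-- Hahn–Banach from the line through `x`; it reduces bounds on seminorms of integrals to scalar
integrals. -/
lemma exists_norming_functional {p : Seminorm ℝ E} (hp : Continuous p) (x : E) :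
    ∃ l : E →L[ℝ] ℝ, l x = p x ∧ ∀ y, |l y| ≤ p y := by
  by_cases hx : x = 0
  · exact ⟨0, by simp [hx], fun y => by simp⟩
  · let f : E →ₗ.[ℝ] ℝ := LinearPMap.mkSpanSingleton x (p x) hx
    have hf : ∀ y : f.domain, f.toFun y ≤ p y := by
      rintro ⟨y, hy⟩
      obtain ⟨c, rfl⟩ := Submodule.mem_span_singleton.1 hy
      have : f.toFun ⟨c • x, hy⟩ = c • p x := LinearPMap.mkSpanSingleton'_apply _ _ _ _ _
      rw [this, map_smul_eq_mul]
      exact mul_le_mul_of_nonneg_right (le_abs_self c) (apply_nonneg p x)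
    obtain ⟨g, hg, hl⟩ := Module.Dual.exists_continuous_extension_of_le_seminorm_real
      f.domain f.toFun hp hf
    refine ⟨g, ?_, hl⟩
    have h1 := hg ⟨x, Submodule.mem_span_singleton_self x⟩
    have h2 : f.toFun ⟨x, Submodule.mem_span_singleton_self x⟩ = p x :=
      LinearPMap.mkSpanSingleton_apply _ _ hx (p x)
    rw [← h2, ← h1]

/-- The pointwise bound is asked on the open interval only, since the operators `W (t - s)` of the
dual splitting are controlled only for `s < t`. -/
lemma seminorm_integral_le [CompleteSpace E] {p : Seminorm ℝ E} (hp : Continuous p) {r t : ℝ}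
    (hrt : r ≤ t) {F : ℝ → E} {k : ℝ → ℝ} (hF : IntervalIntegrable F MeasureTheory.volume r t)
    (hk : IntervalIntegrable k MeasureTheory.volume r t)
    (h : ∀ s ∈ Ioo r t, p (F s) ≤ k s) :
    p (∫ s in r..t, F s) ≤ ∫ s in r..t, k s := by
  obtain ⟨l, hl, hle⟩ := exists_norming_functional hp (∫ s in r..t, F s)
  rw [← hl, ← ContinuousLinearMap.intervalIntegral_comp_comm l hF]
  apply intervalIntegral.integral_mono_on_of_le_Ioo hrt _ hk
  · intro s hs
    exact ((le_abs_self _).trans (hle _)).trans (h s hs)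
  · exact ⟨l.integrable_comp hF.1, l.integrable_comp hF.2⟩

end SeminormIntegral

/-! ### Automatic continuity of lattice norms. -/

namespace LatticeNorm

variable {E : Type*} [NormedAddCommGroup E] [NormedSpace ℝ E] [Lattice E]

lemma map_abs [IsOrderedAddMonoid E] (N : LatticeNorm E) (x : E) : N |x| = N x :=
  le_antisymm (N.solid _ _ (abs_abs x).le) (N.solid _ _ (abs_abs x).ge)

lemma mono [IsOrderedAddMonoid E] (N : LatticeNorm E) {x y : E} (hx : 0 ≤ x) (hxy : x ≤ y) :
    N x ≤ N y :=
  N.solid _ _ (by rwa [abs_of_nonneg hx, abs_of_nonneg (hx.trans hxy)])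

lemma pos (N : LatticeNorm E) {x : E} (hx : x ≠ 0) : 0 < N x :=
  (apply_nonneg N.toSeminorm x).lt_of_ne fun h => hx (N.eq_zero_of x h.symm)

variable [IsOrderedAddMonoid E] [IsOrderedModule ℝ E] [HasSolidNorm E] [CompleteSpace E]

/-- A lattice norm on a Banach lattice is automatically dominated by the norm. -/
lemma exists_le_norm (N : LatticeNorm E) : ∃ c : ℝ, ∀ x, N x ≤ c * ‖x‖ := by
  by_contra! hcon
  choose x hx using fun n : ℕ => hcon ((4 : ℝ) ^ n)
  have hx0 : ∀ n, 0 < ‖x n‖ := by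
    intro n
    rw [norm_pos_iff]
    intro h
    have := hx n
    simp [h] at this
  set y : ℕ → E := fun n => (2 ^ n * ‖x n‖)⁻¹ • |x n|
  have hy0 : ∀ n, 0 ≤ y n := fun n => smul_nonneg (by positivity) (abs_nonneg _)
  have hyn : ∀ n, ‖y n‖ = (1 / 2) ^ n := by
    intro n
    simp only [y]
    rw [norm_smul, norm_abs_eq_norm, Real.norm_of_nonneg (by positivity)]
    field_simp [(hx0 n).ne']
    rw [← mul_pow]; norm_num
  have hsum : Summable y :=
    Summable.of_norm (by simp_rw [hyn]; exact summable_geometric_two)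
  have hle : ∀ n, N (y n) ≤ N (∑' n, y n) := fun n =>
    N.mono (hy0 n) (hsum.le_tsum n fun m _ => hy0 m)
  have hlt : ∀ n, (2 : ℝ) ^ n ≤ N (y n) := by
    intro n
    have h1 : N (y n) = (2 ^ n * ‖x n‖)⁻¹ * N (x n) := by
      simp only [y]
      rw [map_smul_eq_mul, Real.norm_of_nonneg (by positivity), map_abs]
    rw [h1, ← div_eq_inv_mul, le_div_iff₀ (by have := hx0 n; positivity)]
    have h2 := (hx n).le
    have h3 : (4 : ℝ) ^ n = 2 ^ n * 2 ^ n := by rw [← mul_pow]; norm_num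
    rw [h3] at h2
    linarith
  obtain ⟨n, hn⟩ := pow_unbounded_of_one_lt (N (∑' n, y n)) (one_lt_two)
  linarith [hle n, hlt n]

lemma continuous (N : LatticeNorm E) : Continuous N.toSeminorm := by
  obtain ⟨c, hc⟩ := N.exists_le_norm
  refine Seminorm.continuous_of_continuousAt_zero (p := N.toSeminorm) ?_
  rw [ContinuousAt, map_zero]
  refine squeeze_zero (fun x => apply_nonneg _ x) hc ?_
  have : Continuous fun x : E => c * ‖x‖ := by fun_prop
  simpa using this.tendsto 0

lemma continuousOn_orbit (N : LatticeNorm E) (S : C0Semigroup E) (x : E) :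
    ContinuousOn (fun t => N (S.op t x)) (Ici 0) :=
  N.continuous.comp_continuousOn (S.continuous_orbit x)

end LatticeNorm

lemma C0Semigroup.op_add_apply {E : Type*} [NormedAddCommGroup E] [NormedSpace ℝ E]
    (S : C0Semigroup E) {s t : ℝ} (hs : 0 ≤ s) (ht : 0 ≤ t) (x : E) :
    S.op (s + t) x = S.op s (S.op t x) := by
  rw [S.op_add s t hs ht]; rfl

/-! ### Order duality and the positive part of the dual splitting. -/

section Duality

variable {X Y : Type*}
  [NormedAddCommGroup X] [NormedSpace ℝ X] [Lattice X] [IsOrderedAddMonoid X]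
  [NormedAddCommGroup Y] [NormedSpace ℝ Y] [Lattice Y] [IsOrderedAddMonoid Y]
  {B : Y →L[ℝ] X →L[ℝ] ℝ} {S : C0Semigroup X} {Sd : C0Semigroup Y}

lemma OrderDuality.pairing_nonneg (hB : OrderDuality B) {φ : Y} {f : X} (hφ : 0 ≤ φ)
    (hf : 0 ≤ f) : 0 ≤ B φ f :=
  (hB.nonneg_left φ).1 hφ f hf

lemma OrderDuality.pairing_mono_right (hB : OrderDuality B) {φ : Y} {f h : X} (hφ : 0 ≤ φ)
    (hf : f ≤ h) : B φ f ≤ B φ h := by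
  have := hB.pairing_nonneg hφ (sub_nonneg.2 hf)
  rw [map_sub] at this
  linarith

lemma OrderDuality.pairing_mono_left (hB : OrderDuality B) {φ ψ : Y} {f : X} (hφ : φ ≤ ψ)
    (hf : 0 ≤ f) : B φ f ≤ B ψ f := by
  have := hB.pairing_nonneg (sub_nonneg.2 hφ) hf
  rw [map_sub, sub_apply] at this
  linarith

lemma OrderDuality.ext_left (hB : OrderDuality B) {φ ψ : Y} (h : ∀ f, B φ f = B ψ f) :
    φ = ψ := by
  apply le_antisymm
  · rw [← sub_nonneg, hB.nonneg_left]
    intro g _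
    simp [h]
  · rw [← sub_nonneg, hB.nonneg_left]
    intro g _
    simp [h]

lemma OrderDuality.exists_pairing_ne_zero_left (hB : OrderDuality B) {φ : Y} (hφ : φ ≠ 0) :
    ∃ f, B φ f ≠ 0 := by
  by_contra! h
  exact hφ (hB.ext_left fun f => by simp [h f])

lemma OrderDuality.exists_pairing_pos_right (hB : OrderDuality B) {f : X} (hf : 0 ≤ f)
    (hf0 : f ≠ 0) : ∃ ψ, 0 ≤ ψ ∧ 0 < B ψ f := by
  by_contra! h
  apply hf0
  refine le_antisymm ?_ hf
  rw [← neg_nonneg, hB.nonneg_right]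
  intro ψ hψ
  rw [map_neg]
  linarith [h ψ hψ]

lemma DualSemigroups.isPositive (hB : OrderDuality B) (hS : S.IsPositive)
    (hd : DualSemigroups B S Sd) : Sd.IsPositive := by
  intro t ht φ hφ
  rw [hB.nonneg_left]
  intro g hg
  rw [← hd t ht]
  exact hB.pairing_nonneg hφ (hS t ht g hg)

lemma C0Semigroup.IsPositive.mono (hS : S.IsPositive) {t : ℝ} (ht : 0 ≤ t)
    {x y : X} (h : x ≤ y) : S.op t x ≤ S.op t y := by
  have := hS t ht _ (sub_nonneg.2 h)
  rwa [map_sub, sub_nonneg] at this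

lemma C0Semigroup.IsPositive.abs_le (hS : S.IsPositive) {t : ℝ} (ht : 0 ≤ t) (x : X) :
    |S.op t x| ≤ S.op t |x| := by
  apply abs_le'.2
  refine ⟨hS.mono ht (le_abs_self x), ?_⟩
  rw [← map_neg]
  exact hS.mono ht (neg_le_abs x)

variable [IsOrderedModule ℝ Y] [HasSolidNorm Y] [CompleteSpace Y]

/-- The dual splitting decomposes an orbit into a part that is small for `‖·‖₀` and a nonnegative
part that is controlled for `‖·‖₁`. -/
lemma DualSplitting.exists_decomposition {lam C₀ C₁ : ℝ} {NY : Fin 2 → LatticeNorm Y}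
    (hsplit : DualSplitting lam C₀ C₁ Sd NY) (hB : OrderDuality B) (hSd : Sd.IsPositive)
    {φ : Y} (hφ : 0 ≤ φ) {t : ℝ} (ht : 0 < t) :
    ∃ w : Y, 0 ≤ w ∧ NY 0 (Sd.op t φ - w) ≤ C₀ * Real.exp (lam * t) * NY 0 φ ∧
      NY 1 w ≤ C₁ * ∫ s in (0 : ℝ)..t, Real.exp (lam * (t - s)) * NY 0 (Sd.op s φ) := by
  obtain ⟨V, W, hVW, hV, hW, hWpos⟩ := hsplit
  obtain ⟨hint, heq⟩ := hVW t φ ht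
  refine ⟨∫ s in (0 : ℝ)..t, W (t - s) (Sd.op s φ), ?_, ?_, ?_⟩
  · rw [hB.nonneg_left]
    intro g hg
    have h1 : B (∫ s in (0 : ℝ)..t, W (t - s) (Sd.op s φ)) g
        = ∫ s in (0 : ℝ)..t, B (W (t - s) (Sd.op s φ)) g :=
      (ContinuousLinearMap.intervalIntegral_comp_comm (B.flip g) hint).symm
    have h0 : ∫ s in (0 : ℝ)..t, (0 : ℝ) = 0 := by simp
    rw [h1]
    refine h0.symm.le.trans ?_
    apply intervalIntegral.integral_mono_on_of_le_Ioo ht.le intervalIntegrable_const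
    · exact ⟨(B.flip g).integrable_comp hint.1, (B.flip g).integrable_comp hint.2⟩
    · intro s hs
      exact hB.pairing_nonneg (hWpos _ _ (sub_pos.2 hs.2) (hSd s hs.1.le φ hφ)) hg
  · have : Sd.op t φ - ∫ s in (0 : ℝ)..t, W (t - s) (Sd.op s φ) = V t φ := by
      rw [heq, add_sub_cancel_right]
    rw [this]
    exact hV t φ ht
  · rw [← intervalIntegral.integral_const_mul]
    apply seminorm_integral_le (NY 1).continuous ht.le hint
    · apply ContinuousOn.intervalIntegrable
      rw [uIcc_of_le ht.le]
      have h2 := ((NY 0).continuousOn_orbit Sd φ).mono (show Icc 0 t ⊆ Ici 0 from Icc_subset_Ici_self)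
      have h3 : Continuous fun s : ℝ => Real.exp (lam * (t - s)) := by fun_prop
      exact (h3.continuousOn.mul h2).const_mul C₁
    · intro s hs
      rw [← mul_assoc]
      exact hW _ _ (sub_pos.2 hs.2)

end Duality

/-! ### Convergence of a Laplace transform forces decay of the dual semigroup. -/

section Decay

variable {X Y : Type*}
  [NormedAddCommGroup X] [NormedSpace ℝ X] [Lattice X] [IsOrderedAddMonoid X]
  [IsOrderedModule ℝ X] [HasSolidNorm X] [CompleteSpace X]
  [NormedAddCommGroup Y] [NormedSpace ℝ Y] [Lattice Y] [IsOrderedAddMonoid Y]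
  [IsOrderedModule ℝ Y] [HasSolidNorm Y] [CompleteSpace Y]
  {B : Y →L[ℝ] X →L[ℝ] ℝ} {S : C0Semigroup X} {Sd : C0Semigroup Y}
  {NX : Fin 2 → LatticeNorm X} {NY : Fin 2 → LatticeNorm Y} {lam C₀ C₁ : ℝ}

lemma LatticeNorm.continuousOn_rescaled_orbit {E : Type*} [NormedAddCommGroup E]
    [NormedSpace ℝ E] [Lattice E] [IsOrderedAddMonoid E] [IsOrderedModule ℝ E] [HasSolidNorm E]
    [CompleteSpace E] (N : LatticeNorm E) (S : C0Semigroup E) (κ : ℝ) (x : E) :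
    ContinuousOn (fun t => Real.exp (-(κ * t)) * N (S.op t x)) (Ici 0) :=
  (by fun_prop : Continuous fun t : ℝ => Real.exp (-(κ * t))).continuousOn.mul
    (N.continuousOn_orbit S x)

lemma continuousOn_pairing_orbit (ψ : Y) (g : X) :
    ContinuousOn (fun t => B ψ (S.op t g)) (Ici 0) :=
  (B ψ).continuous.comp_continuousOn (S.continuous_orbit g)

lemma continuousOn_rescaled_pairing_orbit (κ : ℝ) (ψ : Y) (g : X) :
    ContinuousOn (fun t => Real.exp (-(κ * t)) * B ψ (S.op t g)) (Ici 0) :=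
  (by fun_prop : Continuous fun t : ℝ => Real.exp (-(κ * t))).continuousOn.mul
    (continuousOn_pairing_orbit ψ g)

/-- Dissipativity for `‖·‖₁`, after rescaling and interpolation. -/
lemma StronglyDissipative.rescaled_le (hdiss : StronglyDissipative lam C₀ C₁ S NX)
    (hC₁ : 0 ≤ C₁) (κ : ℝ) {x : ℝ} {f : X} {v : ℝ → ℝ} (hv : ContinuousOn v (Ici 0))
    (hint : ∀ s, 0 ≤ s → Real.exp (-(κ * s)) * NX 0 (S.op s f)
      ≤ x * (Real.exp (-(κ * s)) * NX 1 (S.op s f)) + v s) {t : ℝ} (ht : 0 < t) :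
    Real.exp (-(κ * t)) * NX 1 (S.op t f) ≤
      C₀ * Real.exp (-((κ - lam) * t)) * NX 1 f
        + C₁ * (∫ s in (0 : ℝ)..t, Real.exp (-((κ - lam) * (t - s))) * v s)
        + C₁ * x * ∫ s in (0 : ℝ)..t,
          Real.exp (-((κ - lam) * (t - s))) * (Real.exp (-(κ * s)) * NX 1 (S.op s f)) := by
  have h1 := mul_le_mul_of_nonneg_left (hdiss 1 f t ht) (Real.exp_pos (-(κ * t))).le
  have e1 : Real.exp (-(κ * t)) * Real.exp (lam * t) = Real.exp (-((κ - lam) * t)) := by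
    rw [← Real.exp_add]; congr 1; ring
  have h2 : Real.exp (-(κ * t)) * (C₀ * Real.exp (lam * t) * NX 1 f
      + C₁ * ∫ s in (0 : ℝ)..t, Real.exp (lam * (t - s)) * NX 0 (S.op s f))
      = C₀ * Real.exp (-((κ - lam) * t)) * NX 1 f + C₁ * ∫ s in (0 : ℝ)..t,
        Real.exp (-((κ - lam) * (t - s))) * (Real.exp (-(κ * s)) * NX 0 (S.op s f)) := by
    rw [← exp_mul_integral_rescale, ← e1]; ring
  rw [h2] at h1
  have c0 := ((NX 0).continuousOn_rescaled_orbit S κ f).mono (show Icc 0 t ⊆ Ici 0 from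
    Icc_subset_Ici_self)
  have c1 := ((NX 1).continuousOn_rescaled_orbit S κ f).mono (show Icc 0 t ⊆ Ici 0 from
    Icc_subset_Ici_self)
  have c2 := hv.mono (show Icc 0 t ⊆ Ici 0 from Icc_subset_Ici_self)
  have i1 := intervalIntegrable_expKernel_mul (a := κ - lam) t ht.le c1
  have i2 := intervalIntegrable_expKernel_mul (a := κ - lam) t ht.le c2
  have h3 : ∫ s in (0 : ℝ)..t,
        Real.exp (-((κ - lam) * (t - s))) * (Real.exp (-(κ * s)) * NX 0 (S.op s f))
      ≤ ∫ s in (0 : ℝ)..t,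
        (x * (Real.exp (-((κ - lam) * (t - s))) * (Real.exp (-(κ * s)) * NX 1 (S.op s f)))
          + Real.exp (-((κ - lam) * (t - s))) * v s) := by
    apply intervalIntegral.integral_mono_on ht.le
      (intervalIntegrable_expKernel_mul (a := κ - lam) t ht.le c0) ((i1.const_mul x).add i2)
    intro s hs
    have := mul_le_mul_of_nonneg_left (hint s hs.1) (Real.exp_pos (-((κ - lam) * (t - s)))).le
    linarith
  rw [intervalIntegral.integral_add (i1.const_mul x) i2, intervalIntegral.integral_const_mul]
    at h3
  have h4 := mul_le_mul_of_nonneg_left h3 hC₁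
  linarith

variable {x Ξ₀ : ℝ} {g : X} {ψ : Y}

/-- If the Laplace transform of `t ↦ ⟨ψ, S t g⟩` converges at `κ`, then `e^{-κ t} ‖S t g‖₁` is
bounded and tends to `0`. -/
lemma rescaled_orbit_tendsto_zero (hB : OrderDuality B) (hS : S.IsPositive)
    (hdiss : StronglyDissipative lam C₀ C₁ S NX) (hC₀ : 0 < C₀) (hC₁ : 0 < C₁)
    (hg : 0 ≤ g) (hψ : 0 ≤ ψ) (hx : 0 < x) (hΞ₀ : 0 < Ξ₀)
    (hint : ∀ f, NX 0 f ≤ x * NX 1 f + Ξ₀ * bracketX B ψ f)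
    {κ J : ℝ} (hκ : C₁ * x ≤ (κ - lam) / 2)
    (hJ : ∀ τ, 0 ≤ τ → ∫ t in (0 : ℝ)..τ, Real.exp (-(κ * t)) * B ψ (S.op t g) ≤ J) :
    (∃ D, ∀ t, 0 ≤ t → Real.exp (-(κ * t)) * NX 1 (S.op t g) ≤ D) ∧
      Tendsto (fun t => Real.exp (-(κ * t)) * NX 1 (S.op t g)) atTop (𝓝 0) := by
  have ha : 0 < κ - lam := by have := mul_pos hC₁ hx; linarith
  set u : ℝ → ℝ := fun t => Real.exp (-(κ * t)) * NX 1 (S.op t g) with hu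
  set h : ℝ → ℝ := fun t => Real.exp (-(κ * t)) * B ψ (S.op t g) with hh
  have hh0 : ∀ t, 0 ≤ t → 0 ≤ h t := fun t ht =>
    mul_nonneg (Real.exp_pos _).le (hB.pairing_nonneg hψ (hS t ht g hg))
  have hhc : ContinuousOn h (Ici 0) := continuousOn_rescaled_pairing_orbit κ ψ g
  have hG : 0 ≤ NX 1 g := apply_nonneg _ _
  have hJ0 : 0 ≤ J := by simpa using hJ 0 le_rfl
  set β : ℝ → ℝ := fun t => C₀ * Real.exp (-((κ - lam) * t)) * NX 1 g
    + C₁ * Ξ₀ * ∫ s in (0 : ℝ)..t, Real.exp (-((κ - lam) * (t - s))) * h s with hβ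
  -- The first two terms bound the forcing `β`, the third the initial value `u 0`, and the final 1
  -- makes `D` positive.
  set D : ℝ := C₀ * NX 1 g + C₁ * Ξ₀ * J + NX 1 g + 1 with hD
  have hDpos : 0 < D := by positivity
  have hβD : ∀ t, 0 < t → β t ≤ D := by
    intro t ht
    have e1 : Real.exp (-((κ - lam) * t)) ≤ 1 := Real.exp_le_one_iff.2 (by nlinarith)
    have e2 : ∫ s in (0 : ℝ)..t, Real.exp (-((κ - lam) * (t - s))) * h s ≤ J :=
      (integral_expKernel_mul_le_integral ha ht.le (hhc.mono Icc_subset_Ici_self)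
        fun s hs => hh0 s hs.1).trans (hJ t ht.le)
    have e3 : C₀ * Real.exp (-((κ - lam) * t)) * NX 1 g ≤ C₀ * 1 * NX 1 g := by gcongr
    have e4 : C₁ * Ξ₀ * ∫ s in (0 : ℝ)..t, Real.exp (-((κ - lam) * (t - s))) * h s
        ≤ C₁ * Ξ₀ * J := by gcongr
    simp only [hβ, hD]
    linarith
  have hβ0 : Tendsto β atTop (𝓝 0) := by
    have e1 : Tendsto (fun t => C₀ * Real.exp (-((κ - lam) * t)) * NX 1 g) atTop (𝓝 0) := by
      simpa using ((tendsto_expKernel (κ - lam) 0 ha).const_mul C₀).mul_const (NX 1 g)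
    simpa using e1.add ((tendsto_integral_expKernel_mul ha hhc hh0 hJ).const_mul (C₁ * Ξ₀))
  have huc : ContinuousOn u (Ici 0) := (NX 1).continuousOn_rescaled_orbit S κ g
  have hu0 : ∀ t, 0 ≤ t → 0 ≤ u t := fun t _ =>
    mul_nonneg (Real.exp_pos _).le (apply_nonneg _ _)
  have huz : u 0 ≤ D := by
    simp only [hu, S.op_zero, hD, mul_zero, neg_zero, Real.exp_zero, one_mul,
      ContinuousLinearMap.id_apply]
    have : 0 ≤ C₀ * NX 1 g + C₁ * Ξ₀ * J := by positivity
    linarith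
  have hineq : ∀ t, 0 < t → u t ≤ β t + C₁ * x *
      ∫ s in (0 : ℝ)..t, Real.exp (-((κ - lam) * (t - s))) * u s := by
    intro t ht
    have := hdiss.rescaled_le hC₁.le κ (x := x) (f := g) (v := fun s => Ξ₀ * h s)
      (hhc.const_mul Ξ₀) (fun s hs => by
        have e1 := mul_le_mul_of_nonneg_left (hint (S.op s g)) (Real.exp_pos (-(κ * s))).le
        rw [bracketX, abs_of_nonneg (hS s hs g hg)] at e1
        simp only [hh]
        linarith) ht
    have e2 : ∫ s in (0 : ℝ)..t, Real.exp (-((κ - lam) * (t - s))) * (Ξ₀ * h s)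
        = Ξ₀ * ∫ s in (0 : ℝ)..t, Real.exp (-((κ - lam) * (t - s))) * h s := by
      rw [← intervalIntegral.integral_const_mul]
      congr 1; ext s; ring
    rw [e2] at this
    simp only [hβ]
    linarith
  have hc : 0 ≤ C₁ * x := by positivity
  refine ⟨⟨2 * D, fun t ht => ?_⟩, ?_⟩
  · refine volterra_bounded ha hc hκ (huc.mono Icc_subset_Ici_self) (fun s hs => hu0 s hs.1) huz
      (fun s hs => ?_) t ⟨ht, le_rfl⟩
    exact (hineq s hs.1).trans (by linarith [hβD s hs.1])
  · rw [Metric.tendsto_atTop]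
    intro e he
    obtain ⟨t₀, h0, ht₀⟩ := volterra_decay (F := {u}) ha hc hκ hDpos hβD hβ0
      (by rintro _ rfl; exact huc) (by rintro _ rfl; exact hu0) (by rintro _ rfl; exact huz)
      (by rintro _ rfl; exact hineq) (half_pos he)
    refine ⟨t₀, fun t ht => ?_⟩
    rw [Real.dist_eq, sub_zero, abs_of_nonneg (hu0 t (h0.trans ht))]
    linarith [ht₀ u rfl t ht]

/-- The dual semigroup is `o(e^{κ t})` for the norm `N`, uniformly on the positive cone. -/
def DualDecay (Sd : C0Semigroup Y) (N : LatticeNorm Y) (κ : ℝ) : Prop :=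
  ∀ e : ℝ, 0 < e → ∃ t₀ : ℝ, 0 ≤ t₀ ∧ ∀ φ : Y, 0 ≤ φ → ∀ t, t₀ ≤ t →
    N (Sd.op t φ) ≤ e * Real.exp (κ * t) * N φ

/-- Interpolation is applied only to the positive part `w` of the splitting, whose `‖·‖₁` norm is
controlled. Duality gives `⟨w, g⟩ = ⟨φ, S_t g⟩ - ⟨S*_t φ - w, g⟩`, so the weak term is governed by
the single primal orbit of `g` and by the small remainder. -/
lemma DualSplitting.rescaled_le (hsplit : DualSplitting lam C₀ C₁ Sd NY) (hB : OrderDuality B)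
    (hSd : Sd.IsPositive) (hd : DualSemigroups B S Sd) (hN : CompatibleNorms B NX NY)
    (hx : 0 < x) (hΞ₀ : 0 < Ξ₀)
    (hint : ∀ φ, NY 0 φ ≤ x * NY 1 φ + Ξ₀ * bracketY B g φ) (κ : ℝ)
    {φ : Y} (hφ : 0 ≤ φ) {t : ℝ} (ht : 0 < t) :
    Real.exp (-(κ * t)) * NY 0 (Sd.op t φ) ≤
      (C₀ * (1 + Ξ₀ * NX 1 g) * Real.exp (-((κ - lam) * t))
        + Ξ₀ * (Real.exp (-(κ * t)) * NX 1 (S.op t g))) * NY 0 φ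
        + C₁ * x * ∫ s in (0 : ℝ)..t,
          Real.exp (-((κ - lam) * (t - s))) * (Real.exp (-(κ * s)) * NY 0 (Sd.op s φ)) := by
  obtain ⟨w, hw, hw0, hw1⟩ := hsplit.exists_decomposition hB hSd hφ ht
  have e1 : NY 0 (Sd.op t φ) ≤ NY 0 (Sd.op t φ - w) + NY 0 w := by
    have := map_add_le_add (NY 0).toSeminorm (Sd.op t φ - w) w
    rwa [sub_add_cancel] at this
  have e2 := hint w
  rw [bracketY, abs_of_nonneg hw] at e2
  have e3 : B w g ≤ NY 0 φ * NX 1 (S.op t g) + NY 0 (Sd.op t φ - w) * NX 1 g := by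
    have h1 : B w g = B φ (S.op t g) - B (Sd.op t φ - w) g := by
      rw [hd t ht.le, map_sub, sub_apply]; ring
    have h2 := (le_abs_self _).trans (hN.pairing_01 φ (S.op t g))
    have h3 := (neg_le_abs _).trans (hN.pairing_01 (Sd.op t φ - w) g)
    linarith
  have hG : 0 ≤ NX 1 g := apply_nonneg _ _
  have e4 : NY 0 (Sd.op t φ) ≤ (C₀ * Real.exp (lam * t) * NY 0 φ) * (1 + Ξ₀ * NX 1 g)
      + Ξ₀ * (NY 0 φ * NX 1 (S.op t g))
      + x * (C₁ * ∫ s in (0 : ℝ)..t, Real.exp (lam * (t - s)) * NY 0 (Sd.op s φ)) := by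
    have h1 := mul_le_mul_of_nonneg_left hw1 hx.le
    have h2 := mul_le_mul_of_nonneg_left e3 hΞ₀.le
    have h3 : NY 0 (Sd.op t φ - w) * (1 + Ξ₀ * NX 1 g)
      ≤ (C₀ * Real.exp (lam * t) * NY 0 φ) * (1 + Ξ₀ * NX 1 g) := by gcongr
    linarith
  have e5 := mul_le_mul_of_nonneg_left e4 (Real.exp_pos (-(κ * t))).le
  refine e5.trans (le_of_eq ?_)
  have e6 : Real.exp (-(κ * t)) * Real.exp (lam * t) = Real.exp (-((κ - lam) * t)) := by
    rw [← Real.exp_add]; congr 1; ring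
  rw [← exp_mul_integral_rescale, ← e6]; ring

/-- If the Laplace transform of `t ↦ ⟨ψ, S t g⟩` converges at `κ`, then the dual semigroup is
`o(e^{κ t})` for the norm `‖·‖₀`. -/
lemma dualDecay_of_laplace (hB : OrderDuality B) (hS : S.IsPositive)
    (hd : DualSemigroups B S Sd) (hN : CompatibleNorms B NX NY)
    (hdiss : StronglyDissipative lam C₀ C₁ S NX) (hsplit : DualSplitting lam C₀ C₁ Sd NY)
    (hC₀ : 0 < C₀) (hC₁ : 0 < C₁)
    (hg : 0 ≤ g) (hψ : 0 ≤ ψ) (hx : 0 < x) (hΞ₀ : 0 < Ξ₀)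
    (hintX : ∀ f, NX 0 f ≤ x * NX 1 f + Ξ₀ * bracketX B ψ f)
    (hintY : ∀ φ, NY 0 φ ≤ x * NY 1 φ + Ξ₀ * bracketY B g φ)
    {κ J : ℝ} (hκ : C₁ * x ≤ (κ - lam) / 2)
    (hJ : ∀ τ, 0 ≤ τ → ∫ t in (0 : ℝ)..τ, Real.exp (-(κ * t)) * B ψ (S.op t g) ≤ J) :
    DualDecay Sd (NY 0) κ := by
  have ha : 0 < κ - lam := by have := mul_pos hC₁ hx; linarith
  obtain ⟨⟨D₁, hD₁⟩, hlim⟩ := rescaled_orbit_tendsto_zero hB hS hdiss hC₀ hC₁ hg hψ hx hΞ₀ hintX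
    hκ hJ
  have hG : 0 ≤ NX 1 g := apply_nonneg _ _
  have hD₁0 : 0 ≤ D₁ :=
    (mul_nonneg (Real.exp_pos _).le (apply_nonneg _ _)).trans (hD₁ 0 le_rfl)
  have hSd := hd.isPositive hB hS
  set β : ℝ → ℝ := fun t => C₀ * (1 + Ξ₀ * NX 1 g) * Real.exp (-((κ - lam) * t))
        + Ξ₀ * (Real.exp (-(κ * t)) * NX 1 (S.op t g)) with hβ
  set D : ℝ := C₀ * (1 + Ξ₀ * NX 1 g) + Ξ₀ * D₁ + 1 with hD
  have hβD : ∀ t, 0 < t → β t ≤ D := by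
    intro t ht
    have e1 : Real.exp (-((κ - lam) * t)) ≤ 1 := Real.exp_le_one_iff.2 (by nlinarith)
    have e2 : C₀ * (1 + Ξ₀ * NX 1 g) * Real.exp (-((κ - lam) * t))
        ≤ C₀ * (1 + Ξ₀ * NX 1 g) * 1 := by gcongr
    have e3 := mul_le_mul_of_nonneg_left (hD₁ t ht.le) hΞ₀.le
    simp only [hβ, hD]
    linarith
  have hβ0 : Tendsto β atTop (𝓝 0) := by
    simpa using ((tendsto_expKernel (κ - lam) 0 ha).const_mul (C₀ * (1 + Ξ₀ * NX 1 g))).add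
      (hlim.const_mul Ξ₀)
  intro e he
  -- Applying the decay lemma to the family of all normalized positive orbits makes the time `t₀`
  -- independent of `φ`.
  obtain ⟨t₀, h0, ht₀⟩ := volterra_decay (β := β) (D := D)
    (F := {u | ∃ φ : Y, 0 ≤ φ ∧ NY 0 φ = 1 ∧
      u = fun t => Real.exp (-(κ * t)) * NY 0 (Sd.op t φ)}) ha
    (by positivity : 0 ≤ C₁ * x) hκ (by positivity) hβD hβ0
    (by rintro _ ⟨φ, -, -, rfl⟩; exact (NY 0).continuousOn_rescaled_orbit Sd κ φ)
    (by
      rintro _ ⟨φ, -, -, rfl⟩ t _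
      exact mul_nonneg (Real.exp_pos _).le (apply_nonneg _ _))
    (by
      rintro _ ⟨φ, -, h1, rfl⟩
      simp only [Sd.op_zero, mul_zero, neg_zero, Real.exp_zero, one_mul,
        ContinuousLinearMap.id_apply, h1, hD]
      have : 0 ≤ C₀ * (1 + Ξ₀ * NX 1 g) + Ξ₀ * D₁ := by positivity
      linarith)
    (by
      rintro _ ⟨φ, hφ, h1, rfl⟩ t ht
      have := hsplit.rescaled_le hB hSd hd hN hx hΞ₀ hintY κ hφ ht
      rwa [h1, mul_one] at this) he
  refine ⟨t₀, h0, fun φ hφ t ht => ?_⟩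
  by_cases hz : φ = 0
  · simp [hz]
  have hpos := (NY 0).pos hz
  have h1 := ht₀ _ ⟨(NY 0 φ)⁻¹ • φ, smul_nonneg (by positivity) hφ, by
    rw [map_smul_eq_mul, Real.norm_of_nonneg (by positivity), inv_mul_cancel₀ hpos.ne'], rfl⟩ t ht
  simp only [map_smul, map_smul_eq_mul] at h1
  rw [Real.norm_of_nonneg (by positivity), Real.exp_neg] at h1
  have hE := Real.exp_pos (κ * t)
  calc NY 0 (Sd.op t φ)
      = (Real.exp (κ * t))⁻¹ * ((NY 0 φ)⁻¹ * NY 0 (Sd.op t φ)) * (Real.exp (κ * t) * NY 0 φ) := by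
        field_simp
    _ ≤ e * (Real.exp (κ * t) * NY 0 φ) := by gcongr
    _ = _ := by ring

end Decay

/-! ### Consequences of dual decay and approximate dual eigenvectors. -/

section DualEigenvector

variable {X Y : Type*}
  [NormedAddCommGroup X] [NormedSpace ℝ X] [Lattice X] [IsOrderedAddMonoid X]
  [IsOrderedModule ℝ X] [HasSolidNorm X] [CompleteSpace X]
  [NormedAddCommGroup Y] [NormedSpace ℝ Y] [Lattice Y] [IsOrderedAddMonoid Y]
  [IsOrderedModule ℝ Y] [HasSolidNorm Y] [CompleteSpace Y]
  {B : Y →L[ℝ] X →L[ℝ] ℝ} {S : C0Semigroup X} {Sd : C0Semigroup Y}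
  {NX : Fin 2 → LatticeNorm X} {NY : Fin 2 → LatticeNorm Y} {lam lam₀ C₀ C₁ : ℝ}

lemma C0Semigroup.IsPositive.le_op_nat_mul {E : Type*} [NormedAddCommGroup E] [NormedSpace ℝ E]
    [Lattice E] [IsOrderedAddMonoid E] [IsOrderedModule ℝ E] {S : C0Semigroup E}
    (hS : S.IsPositive) {t₀ ρ : ℝ} (ht₀ : 0 ≤ t₀) (hρ : 0 ≤ ρ) {x : E} (h : ρ • x ≤ S.op t₀ x)
    (n : ℕ) : ρ ^ n • x ≤ S.op (n * t₀) x := by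
  induction n with
  | zero => simp [S.op_zero]
  | succ n ih =>
    have e : ((n + 1 : ℕ) : ℝ) * t₀ = t₀ + n * t₀ := by push_cast; ring
    rw [e, S.op_add_apply ht₀ (by positivity)]
    calc ρ ^ (n + 1) • x = ρ ^ n • (ρ • x) := by rw [smul_smul, pow_succ]
      _ ≤ ρ ^ n • S.op t₀ x := smul_le_smul_of_nonneg_left h (by positivity)
      _ = S.op t₀ (ρ ^ n • x) := by rw [map_smul]
      _ ≤ _ := hS.mono ht₀ ih

/-- Iterating the supereigenvector inequality gives growth at least `e^{lam₀ t}` along multiples of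
`t₀`, while the semigroup is `o(e^{κ t})`; the little-o is what makes the inequality strict. -/
lemma DualDecay.lt_of_supereigenvector {κ : ℝ} (hdec : DualDecay Sd (NY 0) κ)
    (hB : OrderDuality B) (hS : S.IsPositive) (hd : DualSemigroups B S Sd)
    (hN : CompatibleNorms B NX NY)
    (hsuper : HasSupereigenvector lam₀ S ∨ HasSupereigenvector lam₀ Sd) : lam₀ < κ := by
  have hSd := hd.isPositive hB hS
  have hexp : ∀ (n : ℕ) (t₀ : ℝ), Real.exp (lam₀ * t₀) ^ n = Real.exp (lam₀ * (n * t₀)) := by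
    intro n t₀
    rw [← Real.exp_nat_mul]; congr 1; ring
  have hlt : ∀ t : ℝ, 0 < t → Real.exp (lam₀ * t) < Real.exp (κ * t) → lam₀ < κ := by
    intro t ht h
    exact lt_of_mul_lt_mul_right (Real.exp_lt_exp.1 h) ht.le
  have hlarge : ∀ t₁ t₀ : ℝ, 0 < t₀ → ∃ n : ℕ, 0 < (n : ℝ) * t₀ ∧ t₁ ≤ n * t₀ := by
    intro t₁ t₀ ht₀
    obtain ⟨n, hn⟩ := exists_nat_gt (t₁ / t₀)
    refine ⟨n + 1, by positivity, ?_⟩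
    rw [div_lt_iff₀ ht₀] at hn
    push_cast
    nlinarith
  rcases hsuper with ⟨t₀, ht₀, f, hf, hf0, hfS⟩ | ⟨t₀, ht₀, φ, hφ, hφ0, hφS⟩
  · obtain ⟨ψ, hψ, hpos⟩ := hB.exists_pairing_pos_right hf hf0
    have hψ1 : 0 ≤ NY 0 ψ := apply_nonneg _ _
    have hf1 : 0 ≤ NX 1 f := apply_nonneg _ _
    -- Chosen so that the pairing with `f` ends strictly below `e^{κ t} ⟨ψ, f⟩`; the added 1 avoids
    -- a zero denominator.
    obtain ⟨t₁, -, h⟩ := hdec (B ψ f / (NY 0 ψ * NX 1 f + 1) / 2) (by positivity)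
    obtain ⟨n, hn0, hn⟩ := hlarge t₁ t₀ ht₀
    have h1 := hB.pairing_mono_right hψ
      (hS.le_op_nat_mul ht₀.le (Real.exp_pos _).le hfS n)
    rw [hd _ hn0.le, map_smul, smul_eq_mul, hexp] at h1
    have h2 := h1.trans ((le_abs_self _).trans (hN.pairing_01 _ _))
    have h3 := h2.trans (mul_le_mul_of_nonneg_right (h ψ hψ _ hn) hf1)
    apply hlt _ hn0
    have hE := Real.exp_pos (κ * (n * t₀))
    refine lt_of_mul_lt_mul_right (h3.trans_lt ?_) hpos.le
    have h4 : NY 0 ψ * NX 1 f / (NY 0 ψ * NX 1 f + 1) / 2 < 1 := by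
      have : NY 0 ψ * NX 1 f / (NY 0 ψ * NX 1 f + 1) ≤ 1 :=
        div_le_one_of_le₀ (by linarith) (by positivity)
      linarith
    calc B ψ f / (NY 0 ψ * NX 1 f + 1) / 2 * Real.exp (κ * (n * t₀)) * NY 0 ψ * NX 1 f
        = Real.exp (κ * (n * t₀)) * B ψ f * (NY 0 ψ * NX 1 f / (NY 0 ψ * NX 1 f + 1) / 2) := by
          ring
      _ < Real.exp (κ * (n * t₀)) * B ψ f * 1 := by gcongr
      _ = _ := by ring
  · obtain ⟨t₁, -, h⟩ := hdec (1 / 2) (by norm_num)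
    obtain ⟨n, hn0, hn⟩ := hlarge t₁ t₀ ht₀
    have h1 := (NY 0).mono (smul_nonneg (by positivity) hφ)
      (hSd.le_op_nat_mul ht₀.le (Real.exp_pos _).le hφS n)
    rw [map_smul_eq_mul, Real.norm_of_nonneg (by positivity), hexp] at h1
    have h2 := h1.trans (h φ hφ _ hn)
    have hpos := (NY 0).pos hφ0
    apply hlt _ hn0
    have h3 := le_of_mul_le_mul_right h2 hpos
    linarith [Real.exp_pos (κ * (n * t₀))]

/-- The set of convergence exponents is open to the left: halving over one period `T` propagates
through the semigroup law to a true rate below `κ`. -/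
lemma DualDecay.laplace_lt {κ : ℝ} (hdec : DualDecay Sd (NY 0) κ) (hSd : Sd.IsPositive)
    (hd : DualSemigroups B S Sd) (hN : CompatibleNorms B NX NY) (g : X) {ψ : Y} (hψ : 0 ≤ ψ) :
    ∃ δ : ℝ, 0 < δ ∧ ∀ ρ, κ - δ < ρ → ∃ J, ∀ τ, 0 ≤ τ →
      ∫ t in (0 : ℝ)..τ, Real.exp (-(ρ * t)) * B ψ (S.op t g) ≤ J := by
  obtain ⟨t₀, ht₀, h⟩ := hdec (1 / 2) (by norm_num)
  set T := max t₀ 1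
  have hT : 0 < T := lt_max_of_lt_right one_pos
  set u : ℝ → ℝ := fun t => Real.exp (-(κ * t)) * NY 0 (Sd.op t ψ) with hu
  have hu0 : ∀ t, 0 ≤ u t := fun t => mul_nonneg (Real.exp_pos _).le (apply_nonneg _ _)
  have hstep : ∀ t, 0 ≤ t → u (t + T) ≤ 1 / 2 * u t := by
    intro t ht
    have h1 := h (Sd.op t ψ) (hSd t ht ψ hψ) T (le_max_left _ _)
    rw [← Sd.op_add_apply hT.le ht, add_comm] at h1
    have h2 := mul_le_mul_of_nonneg_left h1 (Real.exp_pos (-(κ * (t + T)))).le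
    have h3 : Real.exp (-(κ * (t + T))) * Real.exp (κ * T) = Real.exp (-(κ * t)) := by
      rw [← Real.exp_add]; congr 1; ring
    calc u (t + T) ≤ _ := h2
      _ = 1 / 2 * (Real.exp (-(κ * (t + T))) * Real.exp (κ * T)) * NY 0 (Sd.op t ψ) := by ring
      _ = 1 / 2 * u t := by rw [h3, hu]; ring
  obtain ⟨D, hD⟩ := isCompact_Icc.bddAbove_image
    (((NY 0).continuousOn_rescaled_orbit Sd κ ψ).mono (show Icc 0 T ⊆ Ici 0 from
      Icc_subset_Ici_self))
  have hD' : ∀ r, 0 ≤ r → r ≤ T → u r ≤ D := fun r h0 h1 => hD ⟨r, ⟨h0, h1⟩, rfl⟩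
  have hD0 : 0 ≤ D := (hu0 0).trans (hD' 0 le_rfl hT.le)
  have hdecay := exp_decay_of_contraction hT (by norm_num) (by norm_num) hD' hD0 hstep
  have hlog : Real.log (1 / 2) < 0 := Real.log_neg (by norm_num) (by norm_num)
  have hG : 0 ≤ NX 1 g := apply_nonneg _ _
  refine ⟨-(Real.log (1 / 2) / T), by
    rw [← neg_div]; exact div_pos (by linarith) hT, fun ρ hρ => ?_⟩
  refine ⟨D / (1 / 2) * NX 1 g / (ρ - κ - Real.log (1 / 2) / T), fun τ hτ => ?_⟩
  apply integral_le_of_le_exp (by linarith) (by positivity) hτ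
    ((continuousOn_rescaled_pairing_orbit ρ ψ g).mono Icc_subset_Ici_self)
  intro t ht
  have h1 : B ψ (S.op t g) ≤ NY 0 (Sd.op t ψ) * NX 1 g := by
    rw [hd t ht.1]
    exact (le_abs_self _).trans (hN.pairing_01 _ _)
  have h2 : Real.exp (-(ρ * t)) = Real.exp (-((ρ - κ) * t)) * Real.exp (-(κ * t)) := by
    rw [← Real.exp_add]; congr 1; ring
  calc Real.exp (-(ρ * t)) * B ψ (S.op t g)
      ≤ Real.exp (-(ρ * t)) * (NY 0 (Sd.op t ψ) * NX 1 g) := by gcongr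
    _ = Real.exp (-((ρ - κ) * t)) * u t * NX 1 g := by rw [h2, hu]; ring
    _ ≤ Real.exp (-((ρ - κ) * t)) * (D / (1 / 2) * Real.exp (Real.log (1 / 2) / T * t))
        * NX 1 g := by
        gcongr
        exact hdecay t ht.1
    _ = D / (1 / 2) * NX 1 g * (Real.exp (-((ρ - κ) * t))
        * Real.exp (Real.log (1 / 2) / T * t)) := by ring
    _ = _ := by rw [← Real.exp_add]; congr 2; ring

lemma continuousOn_rescaled_vector_orbit {E : Type*} [NormedAddCommGroup E] [NormedSpace ℝ E]
    (S : C0Semigroup E) (κ : ℝ) (x : E) :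
    ContinuousOn (fun t => Real.exp (-(κ * t)) • S.op t x) (Ici 0) :=
  (by fun_prop : Continuous fun t : ℝ => Real.exp (-(κ * t))).continuousOn.smul
    (S.continuous_orbit x)

/-- A truncated Laplace transform of an orbit is an eigenvector up to boundary terms. -/
lemma rescaled_op_integral_sub {E : Type*} [NormedAddCommGroup E] [NormedSpace ℝ E]
    [CompleteSpace E] (S : C0Semigroup E) (κ : ℝ) (x : E) {s τ : ℝ} (hs : 0 ≤ s) (hτ : 0 ≤ τ) :
    Real.exp (-(κ * s)) • S.op s (∫ t in (0 : ℝ)..τ, Real.exp (-(κ * t)) • S.op t x)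
      - ∫ t in (0 : ℝ)..τ, Real.exp (-(κ * t)) • S.op t x
      = (∫ t in τ..(τ + s), Real.exp (-(κ * t)) • S.op t x)
        - ∫ t in (0 : ℝ)..s, Real.exp (-(κ * t)) • S.op t x := by
  set F : ℝ → E := fun t => Real.exp (-(κ * t)) • S.op t x with hF
  have hFc : ContinuousOn F (Ici 0) := continuousOn_rescaled_vector_orbit S κ x
  have hint : ∀ r t, 0 ≤ r → r ≤ t → IntervalIntegrable F MeasureTheory.volume r t :=
    fun r t hr hrt => (hFc.mono fun s hs => hr.trans hs.1).intervalIntegrable_of_Icc hrt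
  have h1 : Real.exp (-(κ * s)) • S.op s (∫ t in (0 : ℝ)..τ, F t)
      = ∫ t in (0 : ℝ)..τ, F (t + s) := by
    rw [← ContinuousLinearMap.intervalIntegral_comp_comm _ (hint 0 τ le_rfl hτ),
      ← intervalIntegral.integral_smul]
    apply intervalIntegral.integral_congr
    intro t ht
    rw [uIcc_of_le hτ] at ht
    simp only [hF]
    rw [map_smul, smul_smul, ← Real.exp_add, add_comm t s, S.op_add_apply hs ht.1]
    congr 2; ring
  have h2 := intervalIntegral.integral_add_adjacent_intervals (hint 0 s le_rfl hs)
    (hint s (τ + s) hs (by linarith))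
  have h3 := intervalIntegral.integral_add_adjacent_intervals (hint 0 τ le_rfl hτ)
    (hint τ (τ + s) hτ (by linarith))
  rw [h1, intervalIntegral.integral_comp_add_right, zero_add, sub_eq_sub_iff_add_eq_add,
    add_comm _ (∫ t in (0 : ℝ)..s, F t), h2, add_comm _ (∫ t in (0 : ℝ)..τ, F t), h3]

/-- At the abscissa `ω` of convergence of the Laplace transform of `t ↦ ⟨ψ, S t g⟩`, the dual
semigroup has approximate eigenvectors. -/
lemma exists_approx_eigenvector {g : X} {ψ : Y} {ω : ℝ}
    (hB : OrderDuality B) (hS : S.IsPositive) (hd : DualSemigroups B S Sd)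
    (hN : CompatibleNorms B NX NY) (hg : 0 ≤ g) (hψ : 0 ≤ ψ)
    (hdiv : ∀ J, ∃ τ, 0 ≤ τ ∧ J < ∫ t in (0 : ℝ)..τ, Real.exp (-(ω * t)) * B ψ (S.op t g))
    (hdec : ∀ e, 0 < e → ∃ κ, ω ≤ κ ∧ κ < ω + e ∧ DualDecay Sd (NY 0) κ) (n : ℕ) :
    ∃ (κ : ℝ) (φ : Y), ω ≤ κ ∧ κ ≤ ω + 1 / (n + 1) ∧ 0 ≤ φ ∧ NY 0 φ = 1 ∧
      ∀ s : ℝ, 0 ≤ s → s ≤ n →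
        NY 0 (Real.exp (-(κ * s)) • Sd.op s φ - φ) ≤ 1 / (n + 1) := by
  have hSd := hd.isPositive hB hS
  have hn0 : (0 : ℝ) ≤ n := n.cast_nonneg
  obtain ⟨D, hD⟩ := isCompact_Icc.bddAbove_image
    (((NY 0).continuousOn_rescaled_orbit Sd ω ψ).mono (show Icc 0 (n : ℝ) ⊆ Ici 0 from
      Icc_subset_Ici_self))
  have hDn : ∀ r : ℝ, 0 ≤ r → r ≤ n → Real.exp (-(ω * r)) * NY 0 (Sd.op r ψ) ≤ D :=
    fun r h0 h1 => hD ⟨r, ⟨h0, h1⟩, rfl⟩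
  have hD0 : 0 ≤ D :=
    (mul_nonneg (Real.exp_pos _).le (apply_nonneg _ _)).trans (hDn 0 le_rfl hn0)
  have hψ0 : 0 ≤ NY 0 ψ := apply_nonneg _ _
  have hg0 : 0 ≤ NX 1 g := apply_nonneg _ _
  -- The two boundary terms of the truncated transform have total norm at most `n * (NY 0 ψ + D)`;
  -- dividing by a norm at least `R` brings them below `1 / (n + 1)`.
  set R : ℝ := (n + 1) * (n * (NY 0 ψ + D)) + 1 with hR
  have hRpos : 0 < R := by positivity
  obtain ⟨τ₀, hτ₀, hlarge⟩ := hdiv (2 * ((NX 1 g + 1) * R))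
  have hlog2 : 0 < Real.log 2 := Real.log_pos one_lt_two
  -- So close to `ω` that `e^{-κ t} ≥ e^{-ω t} / 2` on `[0, τ₀]`: the mass produced by the
  -- divergence at `ω` survives at `κ`, where decay is available.
  obtain ⟨κ, hωκ, hκlt, hκdec⟩ := hdec (min (1 / (n + 1)) (Real.log 2 / (τ₀ + 1)))
    (lt_min (by positivity) (by positivity))
  have hκ1 : κ ≤ ω + 1 / (n + 1) := by
    linarith [min_le_left (1 / ((n : ℝ) + 1)) (Real.log 2 / (τ₀ + 1))]
  have hκ2 : (κ - ω) * τ₀ ≤ Real.log 2 := by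
    have h1 : κ - ω ≤ Real.log 2 / (τ₀ + 1) := by
      linarith [min_le_right (1 / ((n : ℝ) + 1)) (Real.log 2 / (τ₀ + 1))]
    rw [le_div_iff₀ (by positivity)] at h1
    nlinarith
  obtain ⟨t₁, ht₁, hdecay⟩ := hκdec 1 one_pos
  set τ := max τ₀ t₁
  have hτ : 0 ≤ τ := hτ₀.trans (le_max_left _ _)
  set F : ℝ → Y := fun t => Real.exp (-(κ * t)) • Sd.op t ψ with hF
  have hFc : ContinuousOn F (Ici 0) := continuousOn_rescaled_vector_orbit Sd κ ψ
  have hint : ∀ r t, 0 ≤ r → r ≤ t → IntervalIntegrable F MeasureTheory.volume r t :=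
    fun r t hr hrt => (hFc.mono fun s hs => hr.trans hs.1).intervalIntegrable_of_Icc hrt
  have hNF : ∀ t, NY 0 (F t) = Real.exp (-(κ * t)) * NY 0 (Sd.op t ψ) := by
    intro t
    simp only [hF]
    rw [map_smul_eq_mul, Real.norm_of_nonneg (Real.exp_pos _).le]
  set Φ : Y := ∫ t in (0 : ℝ)..τ, F t with hΦ
  have hpair : ∀ f, B Φ f = ∫ t in (0 : ℝ)..τ, Real.exp (-(κ * t)) * B ψ (S.op t f) := by
    intro f
    have h1 : B Φ f = ∫ t in (0 : ℝ)..τ, B (F t) f :=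
      (ContinuousLinearMap.intervalIntegral_comp_comm (B.flip f) (hint 0 τ le_rfl hτ)).symm
    rw [h1]
    apply intervalIntegral.integral_congr
    intro t ht
    rw [uIcc_of_le hτ] at ht
    simp only [hF, map_smul, smul_apply, smul_eq_mul]
    rw [hd t ht.1]
  have hΦ0 : 0 ≤ Φ := by
    rw [hB.nonneg_left]
    intro f hf
    rw [hpair]
    exact intervalIntegral.integral_nonneg hτ fun t ht =>
      mul_nonneg (Real.exp_pos _).le (hB.pairing_nonneg hψ (hS t ht.1 f hf))
  have hhpos : ∀ ρ t, 0 ≤ t → 0 ≤ Real.exp (-(ρ * t)) * B ψ (S.op t g) := fun ρ t ht =>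
    mul_nonneg (Real.exp_pos _).le (hB.pairing_nonneg hψ (hS t ht g hg))
  have hhint : ∀ ρ r t, 0 ≤ r → r ≤ t → IntervalIntegrable
      (fun t => Real.exp (-(ρ * t)) * B ψ (S.op t g)) MeasureTheory.volume r t :=
    fun ρ r t hr hrt => ((continuousOn_rescaled_pairing_orbit ρ ψ g).mono
      fun s hs => hr.trans hs.1).intervalIntegrable_of_Icc hrt
  have hbig : (NX 1 g + 1) * R < B Φ g := by
    have h1 : ∫ t in (0 : ℝ)..τ₀, 1 / 2 * (Real.exp (-(ω * t)) * B ψ (S.op t g))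
        ≤ ∫ t in (0 : ℝ)..τ₀, Real.exp (-(κ * t)) * B ψ (S.op t g) := by
      apply intervalIntegral.integral_mono_on hτ₀ ((hhint ω 0 τ₀ le_rfl hτ₀).const_mul _)
        (hhint κ 0 τ₀ le_rfl hτ₀)
      intro t ht
      have e1 : 1 / 2 * Real.exp (-(ω * t)) ≤ Real.exp (-(κ * t)) := by
        have e2 : (1 / 2 : ℝ) = Real.exp (-Real.log 2) := by
          rw [Real.exp_neg, Real.exp_log two_pos]; norm_num
        rw [e2, ← Real.exp_add, Real.exp_le_exp]
        nlinarith [ht.1, ht.2]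
      have e3 := mul_le_mul_of_nonneg_right e1 (hB.pairing_nonneg hψ (hS t ht.1 g hg))
      linarith
    rw [intervalIntegral.integral_const_mul] at h1
    have h2 := intervalIntegral.integral_add_adjacent_intervals (hhint κ 0 τ₀ le_rfl hτ₀)
      (hhint κ τ₀ τ hτ₀ (le_max_left _ _))
    have h3 : 0 ≤ ∫ t in τ₀..τ, Real.exp (-(κ * t)) * B ψ (S.op t g) :=
      intervalIntegral.integral_nonneg (le_max_left _ _) fun t ht => hhpos κ t (hτ₀.trans ht.1)
    rw [hpair]
    linarith
  set ν := NY 0 Φ with hν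
  have hνR : R ≤ ν := by
    have h1 := (le_abs_self _).trans (hN.pairing_01 Φ g)
    have hν0 : 0 ≤ ν := apply_nonneg _ _
    by_contra! hlt
    have h2 : ν * NX 1 g ≤ R * (NX 1 g + 1) := by gcongr; linarith
    linarith
  have hν0 : 0 < ν := hRpos.trans_le hνR
  refine ⟨κ, ν⁻¹ • Φ, hωκ, hκ1, smul_nonneg (by positivity) hΦ0, ?_, fun s hs hsn => ?_⟩
  · rw [map_smul_eq_mul, Real.norm_of_nonneg (by positivity), inv_mul_cancel₀ hν0.ne']
  have h1 : Real.exp (-(κ * s)) • Sd.op s (ν⁻¹ • Φ) - ν⁻¹ • Φ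
      = ν⁻¹ • ((∫ t in τ..(τ + s), F t) - ∫ t in (0 : ℝ)..s, F t) := by
    rw [← rescaled_op_integral_sub Sd κ ψ hs hτ, smul_sub, map_smul, smul_comm]
  -- Beyond `t₁` decay bounds the integrand by `NY 0 ψ`; this is why `τ` was taken at least `t₁`.
  have h2 : NY 0 (∫ t in τ..(τ + s), F t) ≤ s * NY 0 ψ := by
    have := seminorm_integral_le (NY 0).continuous (by linarith : τ ≤ τ + s)
      (hint τ (τ + s) hτ (by linarith)) (k := fun _ => NY 0 ψ) intervalIntegrable_const
      (fun t ht => by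
        rw [hNF]
        have e1 := hdecay ψ hψ t ((le_max_right _ _).trans ht.1.le)
        have e2 := mul_le_mul_of_nonneg_left e1 (Real.exp_pos (-(κ * t))).le
        refine e2.trans (le_of_eq ?_)
        rw [one_mul, ← mul_assoc, ← Real.exp_add, neg_add_cancel, Real.exp_zero, one_mul])
    rw [intervalIntegral.integral_const, smul_eq_mul] at this
    linarith
  have h3 : NY 0 (∫ t in (0 : ℝ)..s, F t) ≤ s * D := by
    have := seminorm_integral_le (NY 0).continuous hs
      (hint 0 s le_rfl hs) (k := fun _ => D) intervalIntegrable_const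
      (fun t ht => by
        rw [hNF]
        refine le_trans ?_ (hDn t ht.1.le (ht.2.le.trans hsn))
        refine mul_le_mul_of_nonneg_right ?_ (apply_nonneg _ _)
        rw [Real.exp_le_exp]
        nlinarith [ht.1])
    rw [intervalIntegral.integral_const, smul_eq_mul] at this
    linarith
  rw [h1, map_smul_eq_mul, Real.norm_of_nonneg (by positivity), ← div_eq_inv_mul,
    div_le_div_iff₀ hν0 (by positivity)]
  have h4 := map_sub_le_add (NY 0).toSeminorm (∫ t in τ..(τ + s), F t) (∫ t in (0 : ℝ)..s, F t)
  have h5 : s * (NY 0 ψ + D) ≤ n * (NY 0 ψ + D) := by gcongr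
  have h6 : NY 0 ((∫ t in τ..(τ + s), F t) - ∫ t in (0 : ℝ)..s, F t) ≤ n * (NY 0 ψ + D) := by
    linarith
  have h7 := mul_le_mul_of_nonneg_right h6 (by positivity : (0 : ℝ) ≤ n + 1)
  linarith

end DualEigenvector

/-! ### The critical abscissa and existence of the dual eigenvector. -/

section DualEigenvector

variable {X Y : Type*}
  [NormedAddCommGroup X] [NormedSpace ℝ X] [Lattice X] [IsOrderedAddMonoid X]
  [IsOrderedModule ℝ X] [HasSolidNorm X] [CompleteSpace X]
  [NormedAddCommGroup Y] [NormedSpace ℝ Y] [Lattice Y] [IsOrderedAddMonoid Y]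
  [IsOrderedModule ℝ Y] [HasSolidNorm Y] [CompleteSpace Y]
  {B : Y →L[ℝ] X →L[ℝ] ℝ} {S : C0Semigroup X} {Sd : C0Semigroup Y}
  {NX : Fin 2 → LatticeNorm X} {NY : Fin 2 → LatticeNorm Y} {lam lam₀ lam' C₀ C₁ C₀' : ℝ}
  {x Ξ₀ : ℝ} {g : X} {ψ : Y}

/-- The abscissa of convergence of the Laplace transform of `t ↦ ⟨ψ, S t g⟩` is at least the
rate of any supereigenvector, and the Laplace transform diverges there. -/
lemma exists_abscissa (hlam : lam < lam₀) (hB : OrderDuality B) (hS : S.IsPositive)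
    (hd : DualSemigroups B S Sd) (hN : CompatibleNorms B NX NY)
    (hdiss : StronglyDissipative lam C₀ C₁ S NX) (hsplit : DualSplitting lam C₀ C₁ Sd NY)
    (hsuper : HasSupereigenvector lam₀ S ∨ HasSupereigenvector lam₀ Sd)
    (hgrowth : GrowthBound lam' C₀' S (NX 1))
    (hC₀ : 0 < C₀) (hC₁ : 0 < C₁) (hC₀' : 1 ≤ C₀')
    (hg : 0 ≤ g) (hψ : 0 ≤ ψ) (hx : 0 < x) (hΞ₀ : 0 < Ξ₀)
    (hintX : ∀ f, NX 0 f ≤ x * NX 1 f + Ξ₀ * bracketX B ψ f)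
    (hintY : ∀ φ, NY 0 φ ≤ x * NY 1 φ + Ξ₀ * bracketY B g φ)
    (hxs : C₁ * x ≤ (lam₀ - lam) / 4) :
    ∃ ω, lam₀ ≤ ω ∧
      (∀ J, ∃ τ, 0 ≤ τ ∧ J < ∫ t in (0 : ℝ)..τ, Real.exp (-(ω * t)) * B ψ (S.op t g)) ∧
      ∀ e, 0 < e → ∃ κ, ω ≤ κ ∧ κ < ω + e ∧ DualDecay Sd (NY 0) κ := by
  -- The lower bound `(lam + lam₀) / 2` ensures `C₁ * x ≤ (κ - lam) / 2`. It does not affect the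
  -- infimum, since members of `I` turn out to exceed `lam₀`.
  set I : Set ℝ := {κ | (lam + lam₀) / 2 ≤ κ ∧
    ∃ J, ∀ τ, 0 ≤ τ → ∫ t in (0 : ℝ)..τ, Real.exp (-(κ * t)) * B ψ (S.op t g) ≤ J} with hI
  have hdec : ∀ κ ∈ I, DualDecay Sd (NY 0) κ := by
    rintro κ ⟨h1, J, hJ⟩
    exact dualDecay_of_laplace hB hS hd hN hdiss hsplit hC₀ hC₁ hg hψ hx hΞ₀ hintX hintY
      (by linarith) hJ
  have hlt : ∀ κ ∈ I, lam₀ < κ := fun κ hκ =>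
    (hdec κ hκ).lt_of_supereigenvector hB hS hd hN hsuper
  have hne : I.Nonempty := by
    refine ⟨max ((lam + lam₀) / 2) (lam' + 1), le_max_left _ _, ?_⟩
    set κ := max ((lam + lam₀) / 2) (lam' + 1)
    have hκ : lam' + 1 ≤ κ := le_max_right _ _
    have hψ0 : 0 ≤ NY 0 ψ := apply_nonneg _ _
    have hg0 : 0 ≤ NX 1 g := apply_nonneg _ _
    refine ⟨NY 0 ψ * (C₀' * NX 1 g) / (κ - lam'), fun τ hτ => ?_⟩
    apply integral_le_of_le_exp (by linarith) (by positivity) hτ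
      ((continuousOn_rescaled_pairing_orbit κ ψ g).mono Icc_subset_Ici_self)
    intro t ht
    have h1 : B ψ (S.op t g) ≤ NY 0 ψ * (C₀' * Real.exp (lam' * t) * NX 1 g) :=
      ((le_abs_self _).trans (hN.pairing_01 _ _)).trans
        (mul_le_mul_of_nonneg_left (hgrowth g t ht.1) hψ0)
    refine (mul_le_mul_of_nonneg_left h1 (Real.exp_pos _).le).trans (le_of_eq ?_)
    have h2 : Real.exp (-((κ - lam') * t)) = Real.exp (-(κ * t)) * Real.exp (lam' * t) := by
      rw [← Real.exp_add]; congr 1; ring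
    rw [h2]; ring
  have hbdd : BddBelow I := ⟨lam₀, fun κ hκ => (hlt κ hκ).le⟩
  have hω : lam₀ ≤ sInf I := le_csInf hne fun κ hκ => (hlt κ hκ).le
  have hnot : sInf I ∉ I := by
    intro hmem
    obtain ⟨δ, hδ, h⟩ := (hdec _ hmem).laplace_lt (hd.isPositive hB hS) hd hN g hψ
    have h1 := hlt _ hmem
    set ρ := max (sInf I - δ / 2) ((lam + lam₀) / 2) with hρ
    have hρ1 : ρ < sInf I := max_lt (by linarith) (by linarith)
    have hρ2 : sInf I - δ < ρ := lt_max_of_lt_left (by linarith)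
    exact absurd (csInf_le hbdd (show ρ ∈ I from ⟨le_max_right _ _, h ρ hρ2⟩)) (not_le.2 hρ1)
  refine ⟨sInf I, hω, ?_, fun e he => ?_⟩
  · by_contra! hcon
    obtain ⟨J, hJ⟩ := hcon
    exact hnot ⟨by linarith, J, hJ⟩
  · obtain ⟨κ, hκ, hκe⟩ := exists_lt_of_csInf_lt hne (show sInf I < sInf I + e by linarith)
    exact ⟨κ, csInf_le hbdd hκ, hκe, hdec κ hκ⟩

/-- A near-eigenvector with `‖·‖₀` equal to one is close to an element that is bounded for
`‖·‖₁`. -/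
lemma exists_bounded_approx (hB : OrderDuality B) (hSd : Sd.IsPositive)
    (hsplit : DualSplitting lam C₀ C₁ Sd NY) (hC₀ : 0 < C₀) (hC₁ : 0 < C₁) (hlam : lam < lam₀)
    {κ t e : ℝ} (hκ : lam₀ ≤ κ) (ht : 0 < t) {φ : Y} (hφ : 0 ≤ φ) (hφ1 : NY 0 φ = 1)
    (he : e ≤ 1)
    (happ : ∀ s, 0 ≤ s → s ≤ t → NY 0 (Real.exp (-(κ * s)) • Sd.op s φ - φ) ≤ e) :
    ∃ w, 0 ≤ w ∧ NY 0 (φ - w) ≤ e + C₀ * Real.exp (-((lam₀ - lam) * t)) ∧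
      NY 1 w ≤ 2 * C₁ / (lam₀ - lam) := by
  obtain ⟨w, hw, hw0, hw1⟩ := hsplit.exists_decomposition hB hSd hφ ht
  have hE := Real.exp_pos (-(κ * t))
  refine ⟨Real.exp (-(κ * t)) • w, smul_nonneg hE.le hw, ?_, ?_⟩
  · have h1 : φ - Real.exp (-(κ * t)) • w = Real.exp (-(κ * t)) • (Sd.op t φ - w)
        - (Real.exp (-(κ * t)) • Sd.op t φ - φ) := by
      rw [smul_sub]; abel
    rw [h1]
    have h2 := map_sub_le_add (NY 0).toSeminorm (Real.exp (-(κ * t)) • (Sd.op t φ - w))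
      (Real.exp (-(κ * t)) • Sd.op t φ - φ)
    rw [map_smul_eq_mul, Real.norm_of_nonneg hE.le] at h2
    have h3 : Real.exp (-(κ * t)) * NY 0 (Sd.op t φ - w)
        ≤ C₀ * Real.exp (-((lam₀ - lam) * t)) := by
      calc _ ≤ Real.exp (-(κ * t)) * (C₀ * Real.exp (lam * t) * NY 0 φ) := by gcongr
        _ = C₀ * (Real.exp (-(κ * t)) * Real.exp (lam * t)) := by rw [hφ1]; ring
        _ ≤ C₀ * Real.exp (-((lam₀ - lam) * t)) := by
          rw [← Real.exp_add]
          gcongr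
          nlinarith
    linarith [happ t ht.le le_rfl]
  · rw [map_smul_eq_mul, Real.norm_of_nonneg hE.le]
    have h1 : ∫ s in (0 : ℝ)..t,
        Real.exp (-((κ - lam) * (t - s))) * (Real.exp (-(κ * s)) * NY 0 (Sd.op s φ))
        ≤ 2 / (κ - lam) := by
      apply integral_expKernel_mul_le (by linarith) ht.le
        (((NY 0).continuousOn_rescaled_orbit Sd κ φ).mono Icc_subset_Ici_self) two_pos.le
      intro s hs
      have h2 := map_add_le_add (NY 0).toSeminorm (Real.exp (-(κ * s)) • Sd.op s φ - φ) φ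
      rw [sub_add_cancel, map_smul_eq_mul, Real.norm_of_nonneg (Real.exp_pos _).le] at h2
      linarith [happ s hs.1 hs.2]
    rw [← exp_mul_integral_rescale] at h1
    calc _ ≤ Real.exp (-(κ * t)) *
          (C₁ * ∫ s in (0 : ℝ)..t, Real.exp (lam * (t - s)) * NY 0 (Sd.op s φ)) := by gcongr
      _ = C₁ * (Real.exp (-(κ * t)) *
          ∫ s in (0 : ℝ)..t, Real.exp (lam * (t - s)) * NY 0 (Sd.op s φ)) := by ring
      _ ≤ C₁ * (2 / (κ - lam)) := by gcongr
      _ ≤ C₁ * (2 / (lam₀ - lam)) := by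
          have : 0 < lam₀ - lam := by linarith
          gcongr
      _ = _ := by ring

lemma tendsto_pairing_of_tendsto_norm (hN : CompatibleNorms B NX NY) {u : ℕ → Y} (f : X)
    (hu : Tendsto (fun n => NY 0 (u n)) atTop (𝓝 0)) :
    Tendsto (fun n => B (u n) f) atTop (𝓝 0) := by
  apply squeeze_zero_norm (fun n => hN.pairing_01 (u n) f)
  simpa using hu.mul_const (NX 1 f)

/-- Existence of a nonnegative eigenvector of the dual semigroup. -/
theorem exists_dual_eigenvector (hlam : lam < lam₀) (hB : OrderDuality B) (hS : S.IsPositive)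
    (hd : DualSemigroups B S Sd) (hN : CompatibleNorms B NX NY)
    (hdiss : StronglyDissipative lam C₀ C₁ S NX) (hsplit : DualSplitting lam C₀ C₁ Sd NY)
    (hsuper : HasSupereigenvector lam₀ S ∨ HasSupereigenvector lam₀ Sd)
    (hgrowth : GrowthBound lam' C₀' S (NX 1)) (hcompact : WeaklySeqCompactBalls B (NY 1))
    (hC₀ : 0 < C₀) (hC₁ : 0 < C₁) (hC₀' : 1 ≤ C₀')
    (hg : 0 ≤ g) (hψ : 0 ≤ ψ) (hx : 0 < x) (hΞ₀ : 0 < Ξ₀)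
    (hintX : ∀ f, NX 0 f ≤ x * NX 1 f + Ξ₀ * bracketX B ψ f)
    (hintY : ∀ φ, NY 0 φ ≤ x * NY 1 φ + Ξ₀ * bracketY B g φ)
    (hxs : C₁ * x ≤ (lam₀ - lam) / 4) :
    ∃ (lam₁ : ℝ) (φ : Y), lam₀ ≤ lam₁ ∧ 0 ≤ φ ∧ NY 0 φ = 1 ∧
      ∀ t, 0 ≤ t → Sd.op t φ = Real.exp (lam₁ * t) • φ := by
  have ha : 0 < lam₀ - lam := by linarith
  have hSd := hd.isPositive hB hS
  obtain ⟨ω, hω, hdiv, hdec⟩ := exists_abscissa hlam hB hS hd hN hdiss hsplit hsuper hgrowth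
    hC₀ hC₁ hC₀' hg hψ hx hΞ₀ hintX hintY hxs
  -- The index `n + 1` gives a positive time horizon even for `n = 0`.
  choose κ φ hκ1 hκ2 hφ hφ1 happ using fun n : ℕ =>
    exists_approx_eigenvector hB hS hd hN hg hψ hdiv hdec (n + 1)
  push_cast at hκ2 happ
  have hw : ∀ n : ℕ, ∃ w, 0 ≤ w ∧ NY 0 (φ n - w) ≤
      1 / ((n : ℝ) + 1 + 1) + C₀ * Real.exp (-((lam₀ - lam) * ((n : ℝ) + 1))) ∧
      NY 1 w ≤ 2 * C₁ / (lam₀ - lam) := fun n =>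
    exists_bounded_approx hB hSd hsplit hC₀ hC₁ hlam (hω.trans (hκ1 n)) (by positivity) (hφ n)
      (hφ1 n) (div_le_one_of_le₀ (by linarith [(n.cast_nonneg : (0 : ℝ) ≤ n)]) (by positivity))
      (happ n)
  choose w hw hw0 hw1 using hw
  have hcast : Tendsto (fun n : ℕ => (n : ℝ) + 1) atTop atTop :=
    tendsto_atTop_add_const_right _ _ tendsto_natCast_atTop_atTop
  have hcast2 : Tendsto (fun n : ℕ => 1 / ((n : ℝ) + 1 + 1)) atTop (𝓝 0) :=
    (tendsto_atTop_add_const_right _ _ hcast).const_div_atTop 1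
  have herr : Tendsto (fun n => NY 0 (φ n - w n)) atTop (𝓝 0) := by
    refine squeeze_zero (fun n => apply_nonneg _ _) hw0 ?_
    have h2 := ((tendsto_expKernel (lam₀ - lam) 0 ha).comp hcast).const_mul C₀
    simpa [Function.comp_def] using hcast2.add h2
  obtain ⟨φ', σ, hσ, hlim⟩ := hcompact w _ hw1
  have hσt := hσ.tendsto_atTop
  have hlimφ : ∀ f, Tendsto (fun n => B (φ (σ n)) f) atTop (𝓝 (B φ' f)) := by
    intro f
    have h1 := (tendsto_pairing_of_tendsto_norm hN f herr).comp hσt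
    have h2 := h1.add (hlim f)
    simpa [Function.comp_def] using h2
  have hφ'0 : 0 ≤ φ' := by
    rw [hB.nonneg_left]
    intro f hf
    exact ge_of_tendsto' (hlim f) fun n => hB.pairing_nonneg (hw _) hf
  have hκlim : Tendsto κ atTop (𝓝 ω) := by
    refine tendsto_of_tendsto_of_tendsto_of_le_of_le tendsto_const_nhds ?_ hκ1 hκ2
    simpa using hcast2.const_add ω
  have heig : ∀ t, 0 ≤ t → Sd.op t φ' = Real.exp (ω * t) • φ' := by
    intro t ht
    apply hB.ext_left
    intro f
    -- For fixed `t`, the approximate eigenvector relation is available as soon as the horizon `n +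
    -- 1` exceeds `t`.
    have h0 : Tendsto (fun n => NY 0 (Real.exp (-(κ n * t)) • Sd.op t (φ n) - φ n)) atTop
        (𝓝 0) := by
      refine squeeze_zero' (Eventually.of_forall fun n => apply_nonneg _ _) ?_ hcast2
      filter_upwards [hcast.eventually_ge_atTop t] with n hn
      exact happ n t ht hn
    have h1 := (tendsto_pairing_of_tendsto_norm hN f h0).comp hσt
    have h2 := h1.add (hlimφ f)
    have h3 : Tendsto (fun n => Real.exp (κ (σ n) * t)) atTop (𝓝 (Real.exp (ω * t))) :=
      (Real.continuous_exp.tendsto _).comp ((hκlim.comp hσt).mul_const t)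
    have h4 := h3.mul h2
    have h5 : Tendsto (fun n => B (φ (σ n)) (S.op t f)) atTop
        (𝓝 (Real.exp (ω * t) * (0 + B φ' f))) := by
      refine h4.congr fun n => ?_
      simp only [Function.comp_def, map_sub, map_smul, sub_apply, smul_apply, smul_eq_mul]
      rw [sub_add_cancel, ← mul_assoc, ← Real.exp_add, add_neg_cancel, Real.exp_zero, one_mul,
        hd t ht]
    have h6 := tendsto_nhds_unique h5 (hlimφ (S.op t f))
    rw [← hd t ht, ← h6, map_smul, smul_apply, smul_eq_mul, zero_add]
  -- The norm may drop in the weak limit, but `⟨w, g⟩` passes to it: the `‖·‖₁` term of the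
  -- interpolation takes at most half of the unit norm, leaving `Ξ₀ * ⟨φ', g⟩ ≥ 1 / 2`.
  have hne : φ' ≠ 0 := by
    intro hzero
    have h1 : Tendsto (fun n => NY 0 (φ (σ n) - w (σ n)) + (1 / 2 + Ξ₀ * B (w (σ n)) g)) atTop
        (𝓝 (0 + (1 / 2 + Ξ₀ * B φ' g))) :=
      (herr.comp hσt).add (((hlim g).const_mul Ξ₀).const_add _)
    have h2 : ∀ n, 1 ≤ NY 0 (φ (σ n) - w (σ n)) + (1 / 2 + Ξ₀ * B (w (σ n)) g) := by
      intro n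
      have e1 := map_add_le_add (NY 0).toSeminorm (φ (σ n) - w (σ n)) (w (σ n))
      rw [sub_add_cancel, hφ1] at e1
      have e2 := hintY (w (σ n))
      rw [bracketY, abs_of_nonneg (hw _)] at e2
      have e3 : x * NY 1 (w (σ n)) ≤ 1 / 2 := by
        calc _ ≤ x * (2 * C₁ / (lam₀ - lam)) := by gcongr; exact hw1 _
          _ = 2 * (C₁ * x) / (lam₀ - lam) := by ring
          _ ≤ 1 / 2 := by rw [div_le_iff₀ ha]; linarith
      linarith
    have h3 := ge_of_tendsto' h1 h2
    simp [hzero] at h3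
    norm_num at h3
  have hpos := (NY 0).pos hne
  refine ⟨ω, (NY 0 φ')⁻¹ • φ', hω, smul_nonneg (by positivity) hφ'0, ?_, fun t ht => ?_⟩
  · rw [map_smul_eq_mul, Real.norm_of_nonneg (by positivity), inv_mul_cancel₀ hpos.ne']
  · rw [map_smul, heig t ht, smul_comm]

end DualEigenvector

/-! ### Quantitative bounds on the dual eigenvector, Lyapunov estimate, Harris combination. -/

section Contraction

variable {X Y : Type*}
  [NormedAddCommGroup X] [NormedSpace ℝ X] [Lattice X] [IsOrderedAddMonoid X]
  [IsOrderedModule ℝ X] [HasSolidNorm X] [CompleteSpace X]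
  [NormedAddCommGroup Y] [NormedSpace ℝ Y] [Lattice Y] [IsOrderedAddMonoid Y]
  [IsOrderedModule ℝ Y] [HasSolidNorm Y] [CompleteSpace Y]
  {B : Y →L[ℝ] X →L[ℝ] ℝ} {S : C0Semigroup X} {Sd : C0Semigroup Y}
  {NX : Fin 2 → LatticeNorm X} {NY : Fin 2 → LatticeNorm Y} {lam lam₀ lam' C₀ C₁ C₀' : ℝ}
  {x Ξ₀ : ℝ} {g : X} {ψ φ : Y} {lam₁ : ℝ}

lemma eigenvector_pairing (hd : DualSemigroups B S Sd)
    (heig : ∀ t, 0 ≤ t → Sd.op t φ = Real.exp (lam₁ * t) • φ) {t : ℝ} (ht : 0 ≤ t) (f : X) :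
    B φ (S.op t f) = Real.exp (lam₁ * t) * B φ f := by
  rw [hd t ht, heig t ht, map_smul, smul_apply, smul_eq_mul]

lemma pairing_abs_op_le (hB : OrderDuality B) (hS : S.IsPositive) (hd : DualSemigroups B S Sd)
    (hφ : 0 ≤ φ) (heig : ∀ t, 0 ≤ t → Sd.op t φ = Real.exp (lam₁ * t) • φ) {t : ℝ} (ht : 0 ≤ t)
    (f : X) : B φ |S.op t f| ≤ Real.exp (lam₁ * t) * B φ |f| := by
  rw [← eigenvector_pairing hd heig ht]
  exact hB.pairing_mono_right hφ (hS.abs_le ht f)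

/-- The eigenvalue is at most the growth rate of the semigroup. -/
lemma eigenvalue_le_growth (hB : OrderDuality B) (hd : DualSemigroups B S Sd)
    (hN : CompatibleNorms B NX NY) (hgrowth : GrowthBound lam' C₀' S (NX 1)) (hφ1 : NY 0 φ = 1)
    (heig : ∀ t, 0 ≤ t → Sd.op t φ = Real.exp (lam₁ * t) • φ) : lam₁ ≤ lam' := by
  have hφ0 : φ ≠ 0 := by
    rintro rfl
    simp at hφ1
  obtain ⟨f, hf⟩ := hB.exists_pairing_ne_zero_left hφ0
  by_contra! hlt
  have h1 : ∀ t, 0 ≤ t → |B φ f| ≤ C₀' * NX 1 f * Real.exp (-((lam₁ - lam') * (t - 0))) := by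
    intro t ht
    have e1 := hN.pairing_01 φ (S.op t f)
    rw [eigenvector_pairing hd heig ht, hφ1, one_mul, abs_mul, abs_of_pos (Real.exp_pos _)] at e1
    have e2 := mul_le_mul_of_nonneg_left (e1.trans (hgrowth f t ht))
      (Real.exp_pos (-(lam₁ * t))).le
    have e3 : Real.exp (-(lam₁ * t)) * (Real.exp (lam₁ * t) * |B φ f|) = |B φ f| := by
      rw [← mul_assoc, ← Real.exp_add, neg_add_cancel, Real.exp_zero, one_mul]
    have e4 : Real.exp (-((lam₁ - lam') * (t - 0)))
        = Real.exp (-(lam₁ * t)) * Real.exp (lam' * t) := by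
      rw [← Real.exp_add]; congr 1; ring
    rw [e3] at e2
    rw [e4]
    linarith
  have h2 := (tendsto_expKernel (lam₁ - lam') 0 (by linarith)).const_mul (C₀' * NX 1 f)
  have h3 : |B φ f| ≤ C₀' * NX 1 f * 0 :=
    ge_of_tendsto h2 ((eventually_ge_atTop 0).mono h1)
  rw [mul_zero] at h3
  exact hf (abs_eq_zero.1 (le_antisymm h3 (abs_nonneg _)))

/-- An exact eigenvector has zero defect at every horizon, so the `‖·‖₀` error tends to zero as `t →
∞` under a fixed `‖·‖₁` bound. -/
lemma eigenvector_exists_approx (hlam : lam < lam₀) (hB : OrderDuality B)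
    (hSd : Sd.IsPositive) (hsplit : DualSplitting lam C₀ C₁ Sd NY) (hC₀ : 0 < C₀) (hC₁ : 0 < C₁)
    (hlam₁ : lam₀ ≤ lam₁) (hφ : 0 ≤ φ) (hφ1 : NY 0 φ = 1)
    (heig : ∀ t, 0 ≤ t → Sd.op t φ = Real.exp (lam₁ * t) • φ) {t : ℝ} (ht : 0 < t) :
    ∃ w, 0 ≤ w ∧ NY 0 (φ - w) ≤ C₀ * Real.exp (-((lam₀ - lam) * (t - 0))) ∧
      NY 1 w ≤ 2 * C₁ / (lam₀ - lam) := by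
  have := exists_bounded_approx (e := 0) hB hSd hsplit hC₀ hC₁ hlam hlam₁ ht hφ hφ1 zero_le_one
    (fun s hs _ => by
      rw [heig s hs, smul_smul, ← Real.exp_add, neg_add_cancel, Real.exp_zero, one_smul, sub_self,
        map_zero])
  simpa using this

/-- Only `NY 0 φ` is known, which would pair with `‖f‖₁`. Pairing the approximants, bounded in
`‖·‖₁`, with `‖f‖₀` and letting `t → ∞` gives the stronger bound, with a constant free of `φ`. -/
lemma eigenvector_pairing_le (hlam : lam < lam₀) (hB : OrderDuality B)
    (hSd : Sd.IsPositive) (hN : CompatibleNorms B NX NY)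
    (hsplit : DualSplitting lam C₀ C₁ Sd NY) (hC₀ : 0 < C₀) (hC₁ : 0 < C₁)
    (hlam₁ : lam₀ ≤ lam₁) (hφ : 0 ≤ φ) (hφ1 : NY 0 φ = 1)
    (heig : ∀ t, 0 ≤ t → Sd.op t φ = Real.exp (lam₁ * t) • φ) (f : X) :
    B φ f ≤ 2 * C₁ / (lam₀ - lam) * NX 0 f := by
  have h1 : ∀ t, 0 < t → B φ f ≤ C₀ * Real.exp (-((lam₀ - lam) * (t - 0))) * NX 1 f
      + 2 * C₁ / (lam₀ - lam) * NX 0 f := by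
    intro t ht
    obtain ⟨w, hw, hw0, hw1⟩ := eigenvector_exists_approx hlam hB hSd hsplit hC₀ hC₁ hlam₁ hφ hφ1
      heig ht
    have e1 : B φ f = B (φ - w) f + B w f := by rw [map_sub, sub_apply]; ring
    have e2 := (le_abs_self _).trans (hN.pairing_01 (φ - w) f)
    have e3 := (le_abs_self _).trans (hN.pairing_10 w f)
    have e4 := mul_le_mul_of_nonneg_right hw0 (apply_nonneg (NX 1).toSeminorm f)
    have e5 := mul_le_mul_of_nonneg_right hw1 (apply_nonneg (NX 0).toSeminorm f)
    linarith
  have h2 := (((tendsto_expKernel (lam₀ - lam) 0 (by linarith)).const_mul C₀).mul_const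
    (NX 1 f)).add_const (2 * C₁ / (lam₀ - lam) * NX 0 f)
  have h3 := ge_of_tendsto h2 ((eventually_gt_atTop 0).mono h1)
  linarith

/-- Quantitative form of the nonvanishing argument: interpolating the approximants and letting `t →
∞` leaves `1 ≤ 1 / 2 + Ξ₀ * ⟨φ, g⟩`. -/
lemma eigenvector_pairing_ge (hlam : lam < lam₀) (hB : OrderDuality B)
    (hSd : Sd.IsPositive) (hN : CompatibleNorms B NX NY)
    (hsplit : DualSplitting lam C₀ C₁ Sd NY) (hC₀ : 0 < C₀) (hC₁ : 0 < C₁)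
    (hlam₁ : lam₀ ≤ lam₁) (hφ : 0 ≤ φ) (hφ1 : NY 0 φ = 1)
    (heig : ∀ t, 0 ≤ t → Sd.op t φ = Real.exp (lam₁ * t) • φ) (hx : 0 < x) (hΞ₀ : 0 < Ξ₀)
    (hint : ∀ φ, NY 0 φ ≤ x * NY 1 φ + Ξ₀ * bracketY B g φ)
    (hxs : x * (2 * C₁ / (lam₀ - lam)) ≤ 1 / 2) :
    1 / (2 * Ξ₀) ≤ B φ g := by
  have h1 : ∀ t, 0 < t → 1 ≤ C₀ * Real.exp (-((lam₀ - lam) * (t - 0))) * (1 + Ξ₀ * NX 1 g)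
      + (1 / 2 + Ξ₀ * B φ g) := by
    intro t ht
    obtain ⟨w, hw, hw0, hw1⟩ := eigenvector_exists_approx hlam hB hSd hsplit hC₀ hC₁ hlam₁ hφ hφ1
      heig ht
    have e1 := map_add_le_add (NY 0).toSeminorm (φ - w) w
    rw [sub_add_cancel, hφ1] at e1
    have e2 := hint w
    rw [bracketY, abs_of_nonneg hw] at e2
    have e3 : B w g = B φ g - B (φ - w) g := by rw [map_sub, sub_apply]; ring
    have e4 := (neg_le_abs _).trans (hN.pairing_01 (φ - w) g)
    have e5 := mul_le_mul_of_nonneg_left hw1 hx.le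
    have e6 : Ξ₀ * B w g ≤ Ξ₀ * (B φ g + NY 0 (φ - w) * NX 1 g) := by gcongr; linarith
    have hg0 : 0 ≤ NX 1 g := apply_nonneg _ _
    have e7 := mul_le_mul_of_nonneg_right hw0 (by positivity : 0 ≤ 1 + Ξ₀ * NX 1 g)
    linarith
  have h2 := (((tendsto_expKernel (lam₀ - lam) 0 (by linarith)).const_mul C₀).mul_const
    (1 + Ξ₀ * NX 1 g)).add_const (1 / 2 + Ξ₀ * B φ g)
  have h3 := ge_of_tendsto h2 ((eventually_gt_atTop 0).mono h1)
  rw [div_le_iff₀ (by positivity)]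
  linarith

/-- Lyapunov-type estimate for the rescaled semigroup. -/
lemma lyapunov_estimate (hlam : lam < lam₀) (hB : OrderDuality B) (hS : S.IsPositive)
    (hd : DualSemigroups B S Sd) (hdiss : StronglyDissipative lam C₀ C₁ S NX)
    (hC₀ : 0 < C₀) (hC₁ : 0 < C₁) (hlam₁ : lam₀ ≤ lam₁) (hφ : 0 ≤ φ)
    (heig : ∀ t, 0 ≤ t → Sd.op t φ = Real.exp (lam₁ * t) • φ) (hx : 0 < x) {M : ℝ} (hM : 0 ≤ M)
    (hint : ∀ f, NX 0 f ≤ x * NX 1 f + M * B φ |f|) (hxs : C₁ * x ≤ (lam₀ - lam) / 4)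
    (f : X) {t : ℝ} (ht : 0 ≤ t) :
    Real.exp (-(lam₁ * t)) * NX 1 (S.op t f) ≤
      2 * (C₀ + 1) * Real.exp (-((lam₀ - lam) / 2 * t)) * NX 1 f
        + 4 * C₁ * M / (lam₀ - lam) * B φ |f| := by
  set a := lam₀ - lam with ha_def
  have ha : 0 < a := by simp only [ha_def]; linarith
  -- Half of the gap is kept as decay rate and the other half makes the Volterra kernel small.
  set κ := lam₁ - a / 2 with hκ
  have hκlam : a / 2 ≤ κ - lam := by simp only [hκ, ha_def]; linarith
  set q := B φ |f| with hq
  have hq0 : 0 ≤ q := hB.pairing_nonneg hφ (abs_nonneg f)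
  have hf0 : 0 ≤ NX 1 f := apply_nonneg _ _
  set u : ℝ → ℝ := fun s => Real.exp (-(κ * s)) * NX 1 (S.op s f) with hu
  set v : ℝ → ℝ := fun s => M * (Real.exp (a / 2 * s) * q) with hv
  have hvc : Continuous v := by simp only [hv]; fun_prop
  -- The forcing grows like `e^{a s / 2}` and is frozen at the horizon `t`; the final factor `e^{-a
  -- t / 2}` cancels it exactly.
  set D : ℝ := (C₀ + 1) * NX 1 f + C₁ * (M * (Real.exp (a / 2 * t) * q) * (2 / a)) with hD
  have hpoint : ∀ s, 0 ≤ s → Real.exp (-(κ * s)) * NX 0 (S.op s f)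
      ≤ x * (Real.exp (-(κ * s)) * NX 1 (S.op s f)) + v s := by
    intro s hs
    have e1 := mul_le_mul_of_nonneg_left (hint (S.op s f)) (Real.exp_pos (-(κ * s))).le
    have e2 := mul_le_mul_of_nonneg_left (pairing_abs_op_le hB hS hd hφ heig hs f) hM
    have e3 := mul_le_mul_of_nonneg_left e2 (Real.exp_pos (-(κ * s))).le
    have e4 : Real.exp (a / 2 * s) = Real.exp (-(κ * s)) * Real.exp (lam₁ * s) := by
      rw [← Real.exp_add]; congr 1; simp only [hκ]; ring
    simp only [hv]
    rw [e4]
    linarith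
  have hb := volterra_bounded (u := u) (D := D) (τ := t) (a := κ - lam) (c := C₁ * x)
    (by linarith) (by positivity) (by linarith)
    (((NX 1).continuousOn_rescaled_orbit S κ f).mono Icc_subset_Ici_self)
    (fun s _ => mul_nonneg (Real.exp_pos _).le (apply_nonneg _ _))
    (by
      simp only [hu, S.op_zero, hD, mul_zero, neg_zero, Real.exp_zero, one_mul,
        ContinuousLinearMap.id_apply]
      have e1 : 0 ≤ C₁ * (M * (Real.exp (a / 2 * t) * q) * (2 / a)) := by positivity
      have e2 : 0 ≤ C₀ * NX 1 f := by positivity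
      linarith)
    (fun s hs => by
      refine (hdiss.rescaled_le hC₁.le κ hvc.continuousOn hpoint hs.1).trans ?_
      have e1 : C₀ * Real.exp (-((κ - lam) * s)) * NX 1 f ≤ C₀ * 1 * NX 1 f := by
        gcongr
        exact Real.exp_le_one_iff.2 (by nlinarith [hs.1])
      have e2 : ∫ r in (0 : ℝ)..s, Real.exp (-((κ - lam) * (s - r))) * v r
          ≤ M * (Real.exp (a / 2 * t) * q) / (κ - lam) := by
        apply integral_expKernel_mul_le (by linarith) hs.1.le hvc.continuousOn (by positivity)
        intro r hr
        have : r ≤ t := hr.2.trans hs.2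
        simp only [hv]
        gcongr
      have e3 : M * (Real.exp (a / 2 * t) * q) / (κ - lam)
          ≤ M * (Real.exp (a / 2 * t) * q) * (2 / a) := by
        rw [div_eq_mul_inv]
        gcongr
        rw [← inv_div a 2]
        gcongr
      have e4 := mul_le_mul_of_nonneg_left (e2.trans e3) hC₁.le
      simp only [hD]
      linarith) t ⟨ht, le_rfl⟩
  have e1 : Real.exp (-(lam₁ * t)) = Real.exp (-(a / 2 * t)) * Real.exp (-(κ * t)) := by
    rw [← Real.exp_add]; congr 1; simp only [hκ]; ring
  have e2 : Real.exp (-(a / 2 * t)) * Real.exp (a / 2 * t) = 1 := by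
    rw [← Real.exp_add, neg_add_cancel, Real.exp_zero]
  calc Real.exp (-(lam₁ * t)) * NX 1 (S.op t f) = Real.exp (-(a / 2 * t)) * u t := by
        rw [e1, hu]; ring
    _ ≤ Real.exp (-(a / 2 * t)) * (2 * D) := by gcongr
    _ = 2 * (C₀ + 1) * Real.exp (-(a / 2 * t)) * NX 1 f
        + 4 * C₁ * M / a * (Real.exp (-(a / 2 * t)) * Real.exp (a / 2 * t)) * q := by
        simp only [hD]; ring
    _ = _ := by rw [e2]; ring

/-- Combination of a Lyapunov and a Doblin estimate into a strict contraction. -/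
lemma harris_combination {q n q' n' K c d : ℝ} (hq : 0 ≤ q) (hn : 0 ≤ n)
    (hK : 0 ≤ K) (hc : 0 < c) (hd : d ≤ 1 / 4) (hd' : d ≤ c / (K + 1) / 4)
    (hqq : q' ≤ q) (hnn : n' ≤ 1 / 4 * n + K * q)
    (hdoeblin : n ≤ (4 * K + 1) * q → q' ≤ (1 - 2 * c) * q) :
    q' + c / (K + 1) * n' ≤ (1 - d) * (q + c / (K + 1) * n) := by
  set β := c / (K + 1) with hβ
  have hβ0 : 0 < β := by positivity
  have hβc : β * K + β = c := by rw [hβ]; field_simp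
  have h1 := mul_le_mul_of_nonneg_left hnn hβ0.le
  -- If `n` is moderate, Doblin gains `2 * c * q`, of which the weight `β` lets the Lyapunov term `β
  -- * K * q` consume at most half. If `n` is large, `K * q ≤ n / 4`, so `n' ≤ n / 2` and this gain
  -- also covers the loss in `q`.
  rcases le_total n ((4 * K + 1) * q) with h | h
  · have h2 := hdoeblin h
    have h3 : β * (K * q) ≤ c * q := by rw [← mul_assoc]; gcongr; linarith
    have h4 : d * (q + β * n) ≤ c * q + β * (3 / 4 * n) := by
      have e1 : d * q ≤ c * q := by
        gcongr
        have : β ≤ c := by nlinarith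
        linarith
      have e2 : d * (β * n) ≤ 1 / 4 * (β * n) := by gcongr
      have e3 : 0 ≤ β * n := by positivity
      linarith
    linarith
  · have h2 : q ≤ n := by nlinarith
    have h3 : K * q ≤ 1 / 4 * n := by nlinarith
    have h4 := mul_le_mul_of_nonneg_left h3 hβ0.le
    have h5 : d * q ≤ β / 4 * n := by
      calc d * q ≤ β / 4 * q := by gcongr
        _ ≤ β / 4 * n := by gcongr
    have e2 : d * (β * n) ≤ 1 / 4 * (β * n) := by gcongr
    linarith

end Contraction

/-! ### Eigenvectors of the generator and of the semigroup. -/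

section Generator

variable {E : Type*} [NormedAddCommGroup E] [NormedSpace ℝ E]

lemma C0Semigroup.generatorMaps_of_eigenvector (S : C0Semigroup E) {μ : ℝ} {y : E}
    (h : ∀ t, 0 ≤ t → S.op t y = Real.exp (μ * t) • y) : S.GeneratorMaps y (μ • y) := by
  have h1 : HasDerivAt (fun t : ℝ => Real.exp (μ * t) • y) (μ • y) 0 := by
    have e1 : HasDerivAt (fun t : ℝ => Real.exp (μ * t)) μ 0 := by
      simpa using ((hasDerivAt_id' (0 : ℝ)).const_mul μ).exp
    exact e1.smul_const y
  refine h1.tendsto_slope_zero_right.congr' ?_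
  filter_upwards [self_mem_nhdsWithin] with t ht
  rw [h t (le_of_lt ht)]
  simp

/-- The continuous function `e^{-μ r} S_r y` has zero right derivative, hence is constant. -/
lemma C0Semigroup.eigenvector_of_generatorMaps (S : C0Semigroup E) {μ : ℝ} {y : E}
    (h : S.GeneratorMaps y (μ • y)) {t : ℝ} (ht : 0 ≤ t) :
    S.op t y = Real.exp (μ * t) • y := by
  have hder : ∀ r, 0 ≤ r → HasDerivWithinAt (fun r => S.op r y) (μ • S.op r y) (Ici r) r := by
    intro r hr
    rw [← hasDerivWithinAt_Ioi_iff_Ici, hasDerivWithinAt_iff_tendsto_slope' self_notMem_Ioi]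
    have h1 : Tendsto (fun z : ℝ => z - r) (𝓝[>] r) (𝓝[>] 0) := by
      apply tendsto_nhdsWithin_of_tendsto_nhds_of_eventually_within
      · have : Continuous fun z : ℝ => z - r := by fun_prop
        simpa using (this.tendsto r).mono_left nhdsWithin_le_nhds
      · filter_upwards [self_mem_nhdsWithin] with z hz
        exact sub_pos.2 (mem_Ioi.1 hz)
    have h2 := ((S.op r).continuous.tendsto _).comp (h.comp h1)
    rw [map_smul] at h2
    refine h2.congr' ?_
    filter_upwards [self_mem_nhdsWithin] with z hz
    have hz' : 0 ≤ z - r := sub_nonneg.2 (le_of_lt hz)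
    simp only [Function.comp_apply, slope, vsub_eq_sub, map_smul, map_sub]
    rw [← S.op_add_apply hr hz', add_sub_cancel]
  have hder' : ∀ r ∈ Ico 0 t,
      HasDerivWithinAt (fun r => Real.exp (-(μ * r)) • S.op r y) 0 (Ici r) r := by
    intro r hr
    have e1 : HasDerivAt (fun r : ℝ => Real.exp (-(μ * r))) (Real.exp (-(μ * r)) * -μ) r := by
      have := ((hasDerivAt_id' r).const_mul (-μ)).exp
      simpa [neg_mul] using this
    have e2 := e1.hasDerivWithinAt.smul (hder r hr.1)
    have e3 : Real.exp (-(μ * r)) • μ • S.op r y + (Real.exp (-(μ * r)) * -μ) • S.op r y = 0 := by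
      rw [smul_smul, ← add_smul]
      simp
    rw [e3] at e2
    exact e2
  have hconst := constant_of_has_deriv_right_zero
    ((continuousOn_rescaled_vector_orbit S μ y).mono (show Icc 0 t ⊆ Ici 0 from
      Icc_subset_Ici_self)) hder' t ⟨ht, le_rfl⟩
  simp only [mul_zero, neg_zero, Real.exp_zero, one_smul, S.op_zero,
    ContinuousLinearMap.id_apply] at hconst
  nth_rewrite 2 [← hconst]
  rw [smul_smul, ← Real.exp_add, add_neg_cancel, Real.exp_zero, one_smul]

end Generator

/-! ### Doblin contraction and exponential decay on the kernel of the dual eigenvector. -/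

section Contraction

variable {X Y : Type*}
  [NormedAddCommGroup X] [NormedSpace ℝ X] [Lattice X] [IsOrderedAddMonoid X]
  [IsOrderedModule ℝ X] [HasSolidNorm X] [CompleteSpace X]
  [NormedAddCommGroup Y] [NormedSpace ℝ Y] [Lattice Y] [IsOrderedAddMonoid Y]
  [IsOrderedModule ℝ Y] [HasSolidNorm Y] [CompleteSpace Y]
  {B : Y →L[ℝ] X →L[ℝ] ℝ} {S : C0Semigroup X} {Sd : C0Semigroup Y}
  {NX : Fin 2 → LatticeNorm X} {NY : Fin 2 → LatticeNorm Y} {lam' C₀' : ℝ}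
  {x Ξ₀ : ℝ} {g : X} {ψ φ : Y} {lam₁ : ℝ}

/-- The dual Doblin condition bounds `ψ` by a multiple of the eigenvector `φ`. -/
lemma pairing_le_eigenvector_pairing (hB : OrderDuality B) (hφ : 0 ≤ φ) (heig : ∀ t, 0 ≤ t → Sd.op t φ = Real.exp (lam₁ * t) • φ)
    {η₀ T₀ T₁ : ℝ} (hT₀ : 0 ≤ T₀) (hT₁ : T₀ < T₁) (hη₀ : 0 < η₀) (hΞ₀ : 0 < Ξ₀)
    (hlam' : lam₁ ≤ lam') (hψ : 0 ≤ ψ)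
    (hdual : (η₀ * bracketY B g (Sd.op T₀ φ)) • ψ ≤ Sd.op T₁ φ) (hge : 1 / (2 * Ξ₀) ≤ B φ g)
    {f : X} (hf : 0 ≤ f) :
    B ψ f ≤ 2 * Ξ₀ * Real.exp (lam' * (T₁ - T₀)) / η₀ * B φ f := by
  have hT₁' : 0 ≤ T₁ := hT₀.trans hT₁.le
  have h1 := hB.pairing_mono_left hdual hf
  have h2 : bracketY B g (Sd.op T₀ φ) = Real.exp (lam₁ * T₀) * B φ g := by
    rw [bracketY, heig T₀ hT₀, abs_of_nonneg (smul_nonneg (Real.exp_pos _).le hφ), map_smul,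
      smul_apply, smul_eq_mul]
  rw [heig T₁ hT₁', map_smul, map_smul, smul_apply, smul_apply, smul_eq_mul, smul_eq_mul, h2]
    at h1
  have h3 : Real.exp (lam₁ * T₁) = Real.exp (lam₁ * T₀) * Real.exp (lam₁ * (T₁ - T₀)) := by
    rw [← Real.exp_add]; congr 1; ring
  -- Replacing `lam₁` by `lam'` makes the constant independent of the unknown eigenvalue.
  have h4 : Real.exp (lam₁ * (T₁ - T₀)) ≤ Real.exp (lam' * (T₁ - T₀)) := by
    rw [Real.exp_le_exp]
    nlinarith
  have hE := Real.exp_pos (lam₁ * T₀)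
  have hψf := hB.pairing_nonneg hψ hf
  have hφf := hB.pairing_nonneg hφ hf
  have h5 : η₀ * B φ g * B ψ f ≤ Real.exp (lam₁ * (T₁ - T₀)) * B φ f := by
    rw [h3] at h1
    refine le_of_mul_le_mul_left ?_ hE
    linarith
  have h6 : η₀ * (1 / (2 * Ξ₀)) * B ψ f ≤ Real.exp (lam' * (T₁ - T₀)) * B φ f := by
    calc _ ≤ η₀ * B φ g * B ψ f := by gcongr
      _ ≤ _ := h5
      _ ≤ _ := by gcongr
  calc B ψ f = 2 * Ξ₀ / η₀ * (η₀ * (1 / (2 * Ξ₀)) * B ψ f) := by field_simp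
    _ ≤ 2 * Ξ₀ / η₀ * (Real.exp (lam' * (T₁ - T₀)) * B φ f) := by gcongr
    _ = _ := by ring

/-- Minorization of the semigroup on nonnegative elements whose norm is controlled. -/
lemma minorization (hd : DualSemigroups B S Sd)
    (heig : ∀ t, 0 ≤ t → Sd.op t φ = Real.exp (lam₁ * t) • φ)
    {K P K₂ A η₀ T₀ T q : ℝ} (hT₀ : 0 ≤ T₀) (hη₀ : 0 < η₀) (hK : 0 < K) (hx : 0 < x)
    (hΞ₀ : 0 < Ξ₀) (hP : 0 ≤ P) (hK₂ : 0 ≤ K₂) (hg : 0 ≤ g)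
    (hle : ∀ f, B φ f ≤ K * NX 0 f)
    (hint : ∀ f, NX 0 f ≤ x * NX 1 f + Ξ₀ * bracketX B ψ f)
    (hlyap : ∀ f, Real.exp (-(lam₁ * T₀)) * NX 1 (S.op T₀ f) ≤ P * NX 1 f + K₂ * B φ |f|)
    (hxs : K * x * (P * A + K₂) ≤ 1 / 4) (hq : 0 ≤ q)
    {f : X} (hf : 0 ≤ f) (hprimal : (η₀ * bracketX B ψ (S.op T₀ f)) • g ≤ S.op T f)
    (hfq : B φ f = q / 2) (hfA : NX 1 f ≤ A * q) :
    (η₀ * (Real.exp (lam₁ * T₀) * q / (4 * K * Ξ₀))) • g ≤ S.op T f := by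
  refine le_trans (smul_le_smul_of_nonneg_right ?_ hg) hprimal
  refine mul_le_mul_of_nonneg_left ?_ hη₀.le
  set h := S.op T₀ f
  have hE := Real.exp_pos (lam₁ * T₀)
  -- The eigenvector mass at time `T₀` bounds `‖h‖₀` from below; interpolation passes this to
  -- `[h]_ψ`, the `‖h‖₁` term using up at most half of it by `hxs`.
  have e1 : Real.exp (lam₁ * T₀) * (q / 2) ≤ K * NX 0 h := by
    rw [← hfq, ← eigenvector_pairing hd heig hT₀]
    exact hle _
  have e2 : NX 1 h ≤ Real.exp (lam₁ * T₀) * ((P * A + K₂) * q) := by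
    have i1 := hlyap f
    rw [abs_of_nonneg hf, hfq, Real.exp_neg, inv_mul_le_iff₀ hE] at i1
    refine i1.trans ?_
    gcongr
    have i2 := mul_le_mul_of_nonneg_left hfA hP
    have i3 : 0 ≤ K₂ * q := by positivity
    linarith
  have e3 : K * NX 0 h ≤ K * (x * NX 1 h + Ξ₀ * bracketX B ψ h) := by
    gcongr
    exact hint h
  have e4 : K * x * NX 1 h ≤ Real.exp (lam₁ * T₀) * q * (1 / 4) := by
    calc K * x * NX 1 h ≤ K * x * (Real.exp (lam₁ * T₀) * ((P * A + K₂) * q)) := by gcongr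
      _ = Real.exp (lam₁ * T₀) * q * (K * x * (P * A + K₂)) := by ring
      _ ≤ _ := by gcongr
  rw [div_le_iff₀ (by positivity)]
  linarith

/-- Since `⟨φ, f⟩ = 0`, the positive and negative parts of `f` carry equal mass `q / 2`. Both images
dominate the same multiple `r • g`, and this common part cancels in `S_T f`. -/
lemma doblin_contraction (hB : OrderDuality B) (hd : DualSemigroups B S Sd)
    (hφ : 0 ≤ φ) (heig : ∀ t, 0 ≤ t → Sd.op t φ = Real.exp (lam₁ * t) • φ)
    {K P K₂ A η₀ T₀ T : ℝ} (hT₀ : 0 ≤ T₀) (hT : T₀ ≤ T) (hη₀ : 0 < η₀) (hK : 0 < K) (hx : 0 < x)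
    (hΞ₀ : 0 < Ξ₀) (hP : 0 ≤ P) (hK₂ : 0 ≤ K₂) (hg : 0 ≤ g) (hlam' : lam₁ ≤ lam')
    (hle : ∀ f, B φ f ≤ K * NX 0 f)
    (hint : ∀ f, NX 0 f ≤ x * NX 1 f + Ξ₀ * bracketX B ψ f)
    (hlyap : ∀ f, Real.exp (-(lam₁ * T₀)) * NX 1 (S.op T₀ f) ≤ P * NX 1 f + K₂ * B φ |f|)
    (hxs : K * x * (P * A + K₂) ≤ 1 / 4) (hge : 1 / (2 * Ξ₀) ≤ B φ g)
    (hprimal : ∀ f, 0 ≤ f → (η₀ * bracketX B ψ (S.op T₀ f)) • g ≤ S.op T f)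
    {f : X} (hf : B φ f = 0) (hfA : NX 1 f ≤ A * B φ |f|) :
    Real.exp (-(lam₁ * T)) * B φ |S.op T f|
      ≤ (1 - 2 * (η₀ * Real.exp (-(lam' * (T - T₀))) / (8 * K * Ξ₀ ^ 2))) * B φ |f| := by
  set q := B φ |f| with hq_def
  have hq : 0 ≤ q := hB.pairing_nonneg hφ (abs_nonneg f)
  have h1 : B φ f⁺ - B φ f⁻ = 0 := by rw [← map_sub, posPart_sub_negPart, hf]
  have h2 : B φ f⁺ + B φ f⁻ = q := by rw [← map_add, posPart_add_negPart]
  set r := η₀ * (Real.exp (lam₁ * T₀) * q / (4 * K * Ξ₀)) with hr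
  have hr0 : 0 ≤ r := by positivity
  have hp : r • g ≤ S.op T f⁺ :=
    minorization hd heig hT₀ hη₀ hK hx hΞ₀ hP hK₂ hg hle hint hlyap hxs hq (posPart_nonneg f)
      (hprimal _ (posPart_nonneg f)) (by linarith)
      (((NX 1).solid _ _ (by
        rw [abs_of_nonneg (posPart_nonneg f)]; exact sup_le (le_abs_self f) (abs_nonneg f))).trans hfA)
  have hn : r • g ≤ S.op T f⁻ :=
    minorization hd heig hT₀ hη₀ hK hx hΞ₀ hP hK₂ hg hle hint hlyap hxs hq (negPart_nonneg f)
      (hprimal _ (negPart_nonneg f)) (by linarith)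
      (((NX 1).solid _ _ (by
        rw [abs_of_nonneg (negPart_nonneg f)]; exact sup_le (neg_le_abs f) (abs_nonneg f))).trans hfA)
  have hSf : S.op T f = S.op T f⁺ - S.op T f⁻ := by rw [← map_sub, posPart_sub_negPart]
  have habs : |S.op T f| ≤ S.op T |f| - (2 * r) • g := by
    have e1 : S.op T |f| = S.op T f⁺ + S.op T f⁻ := by rw [← map_add, posPart_add_negPart]
    rw [e1, two_mul, add_smul, hSf]
    apply abs_le'.2
    constructor
    · rw [← sub_nonneg]
      have : S.op T f⁺ + S.op T f⁻ - (r • g + r • g) - (S.op T f⁺ - S.op T f⁻)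
          = (S.op T f⁻ - r • g) + (S.op T f⁻ - r • g) := by abel
      rw [this]
      exact add_nonneg (sub_nonneg.2 hn) (sub_nonneg.2 hn)
    · rw [← sub_nonneg]
      have : S.op T f⁺ + S.op T f⁻ - (r • g + r • g) - -(S.op T f⁺ - S.op T f⁻)
          = (S.op T f⁺ - r • g) + (S.op T f⁺ - r • g) := by abel
      rw [this]
      exact add_nonneg (sub_nonneg.2 hp) (sub_nonneg.2 hp)
  have h3 := hB.pairing_mono_right hφ habs
  rw [map_sub, map_smul, smul_eq_mul, eigenvector_pairing hd heig (hT₀.trans hT)] at h3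
  have h4 := mul_le_mul_of_nonneg_left h3 (Real.exp_pos (-(lam₁ * T))).le
  have h5 : Real.exp (-(lam₁ * T)) * (Real.exp (lam₁ * T) * q) = q := by
    rw [← mul_assoc, ← Real.exp_add, neg_add_cancel, Real.exp_zero, one_mul]
  have h6 : η₀ * Real.exp (-(lam' * (T - T₀))) / (8 * K * Ξ₀ ^ 2) * q
      ≤ Real.exp (-(lam₁ * T)) * (r * B φ g) := by
    have e1 : Real.exp (-(lam' * (T - T₀)))
        ≤ Real.exp (-(lam₁ * T)) * Real.exp (lam₁ * T₀) := by
      rw [← Real.exp_add, Real.exp_le_exp]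
      nlinarith
    calc η₀ * Real.exp (-(lam' * (T - T₀))) / (8 * K * Ξ₀ ^ 2) * q
        ≤ η₀ * (Real.exp (-(lam₁ * T)) * Real.exp (lam₁ * T₀)) / (8 * K * Ξ₀ ^ 2) * q := by
          gcongr
      _ = Real.exp (-(lam₁ * T)) * (r * (1 / (2 * Ξ₀))) := by
          rw [hr]; field_simp; ring
      _ ≤ _ := by gcongr
  linarith

/-- Exponential decay on the kernel of the dual eigenvector. -/
lemma exp_decay_on_kernel (hB : OrderDuality B) (hd : DualSemigroups B S Sd) (hS : S.IsPositive)
    (hN : CompatibleNorms B NX NY) (hφ : 0 ≤ φ) (hφ1 : NY 0 φ = 1)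
    (heig : ∀ t, 0 ≤ t → Sd.op t φ = Real.exp (lam₁ * t) • φ)
    {P K₂ b c d T : ℝ} (hP : 0 ≤ P) (hK₂ : 0 ≤ K₂) (hb : 0 ≤ b) (hc : 0 < c) (hT : 0 < T)
    (hd0 : 0 < d) (hd4 : d ≤ 1 / 4) (hdc : d ≤ c / (K₂ + 1) / 4)
    (hlyap : ∀ f t, 0 ≤ t → Real.exp (-(lam₁ * t)) * NX 1 (S.op t f)
      ≤ P * Real.exp (-(b * t)) * NX 1 f + K₂ * B φ |f|)
    (hPT : P * Real.exp (-(b * T)) ≤ 1 / 4)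
    (hdoeblin : ∀ f, B φ f = 0 → NX 1 f ≤ (4 * K₂ + 1) * B φ |f| →
      Real.exp (-(lam₁ * T)) * B φ |S.op T f| ≤ (1 - 2 * c) * B φ |f|)
    {f : X} (hf : B φ f = 0) {t : ℝ} (ht : 0 ≤ t) :
    NX 1 (S.op t f) ≤ (1 + c / (K₂ + 1) * (P + K₂)) / (c / (K₂ + 1) * (1 - d))
      * Real.exp ((lam₁ + Real.log (1 - d) / T) * t) * NX 1 f := by
  set β := c / (K₂ + 1) with hβ
  have hβ0 : 0 < β := by positivity
  have hn0 : 0 ≤ NX 1 f := apply_nonneg _ _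
  have hqn : ∀ h : X, B φ |h| ≤ NX 1 h := by
    intro h
    have := (le_abs_self _).trans (hN.pairing_01 φ |h|)
    rwa [hφ1, one_mul, LatticeNorm.map_abs] at this
  have hq_le : ∀ s, 0 ≤ s → ∀ h : X, Real.exp (-(lam₁ * s)) * B φ |S.op s h| ≤ B φ |h| := by
    intro s hs h
    rw [Real.exp_neg, inv_mul_le_iff₀ (Real.exp_pos _)]
    exact pairing_abs_op_le hB hS hd hφ heig hs h
  -- The weighted Harris norm of the rescaled orbit; the kernel of `φ` is invariant, so the
  -- one-period contraction can be iterated.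
  set u : ℝ → ℝ := fun s => Real.exp (-(lam₁ * s)) * (B φ |S.op s f| + β * NX 1 (S.op s f))
    with hu
  have hD : ∀ r, 0 ≤ r → r ≤ T → u r ≤ (1 + β * (P + K₂)) * NX 1 f := by
    intro r hr _
    have e1 := (hq_le r hr f).trans (hqn f)
    have e2 := hlyap f r hr
    have e3 : P * Real.exp (-(b * r)) * NX 1 f ≤ P * 1 * NX 1 f := by
      gcongr
      exact Real.exp_le_one_iff.2 (by nlinarith)
    have e4 := mul_le_mul_of_nonneg_left (hqn f) hK₂
    have e5 : β * (Real.exp (-(lam₁ * r)) * NX 1 (S.op r f)) ≤ β * ((P + K₂) * NX 1 f) :=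
      mul_le_mul_of_nonneg_left (by linarith) hβ0.le
    simp only [hu]
    linarith
  have hstep : ∀ s, 0 ≤ s → u (s + T) ≤ (1 - d) * u s := by
    intro s hs
    set h := S.op s f with hh
    have hSs : S.op (s + T) f = S.op T h := by rw [add_comm, S.op_add_apply hT.le hs]
    have hker : B φ h = 0 := by rw [hh, eigenvector_pairing hd heig hs, hf, mul_zero]
    have e1 := harris_combination (q := B φ |h|) (n := NX 1 h)
      (q' := Real.exp (-(lam₁ * T)) * B φ |S.op T h|)
      (n' := Real.exp (-(lam₁ * T)) * NX 1 (S.op T h))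
      (hB.pairing_nonneg hφ (abs_nonneg h)) (apply_nonneg _ _) hK₂ hc hd4 hdc (hq_le T hT.le h)
      (by
        have i1 := hlyap h T hT.le
        have i2 := mul_le_mul_of_nonneg_right hPT (apply_nonneg (NX 1).toSeminorm h)
        linarith)
      (hdoeblin h hker)
    have e2 := mul_le_mul_of_nonneg_left e1 (Real.exp_pos (-(lam₁ * s))).le
    have e3 : Real.exp (-(lam₁ * (s + T))) = Real.exp (-(lam₁ * s)) * Real.exp (-(lam₁ * T)) := by
      rw [← Real.exp_add]; congr 1; ring
    simp only [hu]
    rw [hSs, e3]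
    linarith
  have hdecay := exp_decay_of_contraction hT (by linarith : 0 < 1 - d) (by linarith) hD
    (by positivity) hstep t ht
  have hq0 := hB.pairing_nonneg hφ (abs_nonneg (S.op t f))
  have hE := Real.exp_pos (lam₁ * t)
  have hE' := Real.exp_pos (-(lam₁ * t))
  have h1 : Real.exp (-(lam₁ * t)) * (β * NX 1 (S.op t f)) ≤ u t := by
    simp only [hu]
    gcongr
    linarith
  have h2 := h1.trans hdecay
  have hd1 : 0 < 1 - d := by linarith
  have h3 : Real.exp ((lam₁ + Real.log (1 - d) / T) * t)
      = Real.exp (lam₁ * t) * Real.exp (Real.log (1 - d) / T * t) := by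
    rw [← Real.exp_add]; congr 1; ring
  rw [Real.exp_neg, inv_mul_le_iff₀ hE] at h2
  rw [h3]
  calc NX 1 (S.op t f) = β⁻¹ * (β * NX 1 (S.op t f)) := by field_simp
    _ ≤ β⁻¹ * (Real.exp (lam₁ * t) * ((1 + β * (P + K₂)) * NX 1 f / (1 - d)
        * Real.exp (Real.log (1 - d) / T * t))) := by gcongr
    _ = _ := by field_simp

end Contraction

/-! ### Primal eigenvector and uniqueness of the triplet. -/

section Eigentriplet

variable {X Y : Type*}
  [NormedAddCommGroup X] [NormedSpace ℝ X] [Lattice X] [IsOrderedAddMonoid X]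
  [IsOrderedModule ℝ X] [HasSolidNorm X] [CompleteSpace X]
  [NormedAddCommGroup Y] [NormedSpace ℝ Y] [Lattice Y] [IsOrderedAddMonoid Y]
  [IsOrderedModule ℝ Y] [HasSolidNorm Y] [CompleteSpace Y]
  {B : Y →L[ℝ] X →L[ℝ] ℝ} {S : C0Semigroup X} {Sd : C0Semigroup Y}
  {NX : Fin 2 → LatticeNorm X} {NY : Fin 2 → LatticeNorm Y} {lam' C₀' : ℝ}
  {φ : Y} {lam₁ C δ : ℝ}

/-- The cone is closed for any lattice norm because `y⁻ ≤ |u - y|` whenever `u ≥ 0`. -/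
lemma LatticeNorm.nonneg_of_tendsto (N : LatticeNorm X) {u : ℕ → X} {y : X}
    (hu : ∀ n, 0 ≤ u n) (h : Tendsto (fun n => N (u n - y)) atTop (𝓝 0)) : 0 ≤ y := by
  have h1 : ∀ n, N y⁻ ≤ N (u n - y) := by
    intro n
    apply N.solid
    rw [abs_of_nonneg (negPart_nonneg y)]
    refine sup_le (le_trans ?_ (le_abs_self _)) (abs_nonneg _)
    rw [sub_eq_add_neg]
    exact le_add_of_nonneg_left (hu n)
  have h2 : N y⁻ = 0 := le_antisymm (ge_of_tendsto' h h1) (apply_nonneg _ _)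
  exact negPart_eq_zero.1 (N.eq_zero_of _ h2)

/-- Exponential decay on the kernel of the dual eigenvector yields a primal eigenvector. -/
lemma exists_primal_eigenvector (hd : DualSemigroups B S Sd)
    (hS : S.IsPositive) (hN : CompatibleNorms B NX NY) (hφ1 : NY 0 φ = 1)
    (heig : ∀ t, 0 ≤ t → Sd.op t φ = Real.exp (lam₁ * t) • φ)
    (hBanach : (NX 1).IsBanach) (hgrowth : GrowthBound lam' C₀' S (NX 1))
    (hδ : 0 < δ) (hC : 1 ≤ C)
    (hdecay : ∀ f, B φ f = 0 → ∀ t, 0 ≤ t →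
      NX 1 (S.op t f) ≤ C * Real.exp ((lam₁ - δ) * t) * NX 1 f)
    {h : X} (hh : 0 ≤ h) (hh1 : B φ h = 1)
    (hbdd : ∃ M, ∀ t, 0 ≤ t → Real.exp (-(lam₁ * t)) * NX 1 (S.op t h) ≤ M) :
    ∃ f₁ : X, 0 ≤ f₁ ∧ B φ f₁ = 1 ∧ ∀ t, 0 ≤ t → S.op t f₁ = Real.exp (lam₁ * t) • f₁ := by
  obtain ⟨M, hM⟩ := hbdd
  set u : ℝ → X := fun t => Real.exp (-(lam₁ * t)) • S.op t h with hu
  have hu1 : ∀ t, 0 ≤ t → B φ (u t) = 1 := by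
    intro t ht
    simp only [hu]
    rw [map_smul, smul_eq_mul, eigenvector_pairing hd heig ht, hh1, mul_one, ← Real.exp_add,
      neg_add_cancel, Real.exp_zero]
  have hu0 : ∀ t, 0 ≤ t → 0 ≤ u t := fun t ht =>
    smul_nonneg (Real.exp_pos _).le (hS t ht h hh)
  have hM0 : 0 ≤ M := (mul_nonneg (Real.exp_pos _).le (apply_nonneg _ _)).trans (hM 0 le_rfl)
  set M' := C * (M + NX 1 h) with hM'
  have hM'0 : 0 ≤ M' := by
    have : 0 ≤ NX 1 h := apply_nonneg _ _
    positivity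
  -- The increment is `e^{-lam₁ t} S_t (u s - h)` with `u s - h` in the kernel of `φ` and bounded,
  -- so decay on the kernel gives the Cauchy property.
  have hdiff : ∀ s t, 0 ≤ s → 0 ≤ t → NX 1 (u (t + s) - u t)
      ≤ M' * Real.exp (-(δ * (t - 0))) := by
    intro s t hs ht
    have e1 : u (t + s) - u t = Real.exp (-(lam₁ * t)) • S.op t (u s - h) := by
      simp only [hu]
      rw [map_sub, smul_sub, map_smul, smul_smul, ← Real.exp_add, S.op_add_apply ht hs]
      congr 3; ring
    have e2 : B φ (u s - h) = 0 := by rw [map_sub, hu1 s hs, hh1, sub_self]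
    have e3 : NX 1 (u s - h) ≤ M + NX 1 h := by
      refine (map_sub_le_add _ _ _).trans (add_le_add ?_ le_rfl)
      simp only [hu]
      rw [map_smul_eq_mul, Real.norm_of_nonneg (Real.exp_pos _).le]
      exact hM s hs
    rw [e1, map_smul_eq_mul, Real.norm_of_nonneg (Real.exp_pos _).le]
    have e4 : Real.exp (-(δ * (t - 0))) = Real.exp (-(lam₁ * t)) * Real.exp ((lam₁ - δ) * t) := by
      rw [← Real.exp_add]; congr 1; ring
    calc _ ≤ Real.exp (-(lam₁ * t)) * (C * Real.exp ((lam₁ - δ) * t) * NX 1 (u s - h)) := by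
          gcongr
          exact hdecay _ e2 t ht
      _ ≤ Real.exp (-(lam₁ * t)) * (C * Real.exp ((lam₁ - δ) * t) * (M + NX 1 h)) := by gcongr
      _ = _ := by rw [e4, hM']; ring
  have hrate : Tendsto (fun n : ℕ => M' * Real.exp (-(δ * ((n : ℝ) - 0)))) atTop (𝓝 0) := by
    simpa using ((tendsto_expKernel δ 0 hδ).comp tendsto_natCast_atTop_atTop).const_mul M'
  obtain ⟨f₁, hf₁⟩ := hBanach (fun n : ℕ => u n) (by
    intro e he
    obtain ⟨n₀, hn₀⟩ := eventually_atTop.1 (hrate.eventually_lt_const he)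
    have hle : ∀ m n : ℕ, n₀ ≤ m → m ≤ n → NX 1 (u n - u m) < e := by
      intro m n hm hmn
      have e1 := hdiff ((n : ℝ) - m) m (sub_nonneg.2 (Nat.cast_le.2 hmn)) m.cast_nonneg
      rw [add_sub_cancel] at e1
      exact e1.trans_lt (hn₀ m hm)
    refine ⟨n₀, fun m n hm hn => ?_⟩
    rcases le_total m n with hmn | hmn
    · rw [map_sub_rev]
      exact hle m n hm hmn
    · exact hle n m hn hmn)
  refine ⟨f₁, (NX 1).nonneg_of_tendsto (fun n => hu0 _ n.cast_nonneg) hf₁, ?_, fun t ht => ?_⟩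
  · have e1 : ∀ n : ℕ, |1 - B φ f₁| ≤ NX 1 (u n - f₁) := by
      intro n
      have := hN.pairing_01 φ (u n - f₁)
      rwa [map_sub, hu1 _ n.cast_nonneg, hφ1, one_mul] at this
    have e2 : |1 - B φ f₁| ≤ 0 := ge_of_tendsto' hf₁ e1
    linarith [abs_eq_zero.1 (le_antisymm e2 (abs_nonneg _))]
  · set E := Real.exp (lam₁ * t) with hE
    have hEpos : 0 < E := Real.exp_pos _
    have e1 : ∀ n : ℕ, NX 1 (S.op t f₁ - E • f₁) ≤ C₀' * Real.exp (lam' * t) * NX 1 (u n - f₁)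
        + E * (M' * Real.exp (-(δ * ((n : ℝ) - 0)))) + E * NX 1 (u n - f₁) := by
      intro n
      have i1 : S.op t f₁ - E • f₁ = E • (u (n + t) - u n) + E • (u n - f₁)
          - S.op t (u n - f₁) := by
        have : E • u (n + t) = S.op t (u n) := by
          simp only [hu, hE]
          rw [smul_smul, ← Real.exp_add, map_smul, add_comm (n : ℝ) t,
            S.op_add_apply ht n.cast_nonneg]
          congr 2; ring
        rw [smul_sub, smul_sub, this, map_sub]
        abel
      have i2 := hdiff t n ht n.cast_nonneg
      have i3 := hgrowth (u n - f₁) t ht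
      have i4 := map_sub_le_add (NX 1).toSeminorm (E • (u (n + t) - u n) + E • (u n - f₁))
        (S.op t (u n - f₁))
      have i5 := map_add_le_add (NX 1).toSeminorm (E • (u (n + t) - u n)) (E • (u n - f₁))
      rw [map_smul_eq_mul, map_smul_eq_mul, Real.norm_of_nonneg hEpos.le] at i5
      rw [i1]
      have i6 := mul_le_mul_of_nonneg_left i2 hEpos.le
      linarith
    have e2 : Tendsto (fun n : ℕ => C₀' * Real.exp (lam' * t) * NX 1 (u n - f₁)
        + E * (M' * Real.exp (-(δ * ((n : ℝ) - 0)))) + E * NX 1 (u n - f₁)) atTop (𝓝 0) := by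
      simpa using ((hf₁.const_mul (C₀' * Real.exp (lam' * t))).add (hrate.const_mul E)).add
        (hf₁.const_mul E)
    have e3 := ge_of_tendsto' e2 e1
    exact sub_eq_zero.1 ((NX 1).eq_zero_of _ (le_antisymm e3 (apply_nonneg _ _)))

/-- Strict positivity of `φ`: if the weak seminorm vanishes, interpolation gives `‖f‖₀ ≤ e * ‖f‖₁`
for arbitrarily small `e`. -/
lemma eq_zero_of_pairing_eq_zero
    (hinterp : ∀ e, 0 < e → ∃ M, ∀ f, NX 0 f ≤ e * NX 1 f + M * B φ |f|) {f : X} (hf : 0 ≤ f)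
    (h : B φ f = 0) : f = 0 := by
  apply (NX 0).eq_zero_of
  refine le_antisymm (le_of_forall_pos_le_add fun e he => ?_) (apply_nonneg _ _)
  have hn : 0 ≤ NX 1 f := apply_nonneg _ _
  obtain ⟨M, hM⟩ := hinterp (e / (NX 1 f + 1)) (by positivity)
  have h1 := hM f
  rw [abs_of_nonneg hf, h, mul_zero, add_zero] at h1
  have h2 : e / (NX 1 f + 1) * NX 1 f ≤ e := by
    rw [div_mul_eq_mul_div, div_le_iff₀ (by positivity)]
    nlinarith
  linarith

/-- Uniqueness of the eigentriplet. -/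
lemma eigentriplet_unique (hB : OrderDuality B) (hd : DualSemigroups B S Sd)
    (hN : CompatibleNorms B NX NY)
    (hφ1 : NY 0 φ = 1) (heig : ∀ t, 0 ≤ t → Sd.op t φ = Real.exp (lam₁ * t) • φ)
    (hδ : 0 < δ)
    (hdecay : ∀ f, B φ f = 0 → ∀ t, 0 ≤ t →
      NX 1 (S.op t f) ≤ C * Real.exp ((lam₁ - δ) * t) * NX 1 f)
    (hinterp : ∀ e, 0 < e → ∃ M, ∀ f, NX 0 f ≤ e * NX 1 f + M * B φ |f|)
    {f₁ : X} (hf₁ : 0 ≤ f₁) (hf₁1 : B φ f₁ = 1)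
    (hSf₁ : ∀ t, 0 ≤ t → S.op t f₁ = Real.exp (lam₁ * t) • f₁)
    {μ : ℝ} {f : X} {φ' : Y} (htrip : IsEigentriplet B S Sd (NY 0) μ f φ') :
    μ = lam₁ ∧ f = f₁ ∧ φ' = φ := by
  have hSf : ∀ t, 0 ≤ t → S.op t f = Real.exp (μ * t) • f := fun t ht =>
    S.eigenvector_of_generatorMaps htrip.primal ht
  have hSφ' : ∀ t, 0 ≤ t → Sd.op t φ' = Real.exp (μ * t) • φ' := fun t ht =>
    Sd.eigenvector_of_generatorMaps htrip.dual ht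
  have hfne : f ≠ 0 := by
    rintro rfl
    simpa using htrip.pairing
  have hpne : B φ f ≠ 0 := fun h0 =>
    hfne (eq_zero_of_pairing_eq_zero hinterp htrip.primal_nonneg h0)
  have hμ : μ = lam₁ := by
    have e1 := eigenvector_pairing hd heig zero_le_one f
    rw [hSf 1 zero_le_one, map_smul, smul_eq_mul] at e1
    have e2 := Real.exp_injective (mul_right_cancel₀ hpne e1)
    simpa using e2
  subst hμ
  have hker : ∀ k : X, B φ k = 0 → ∀ t, 0 ≤ t → Real.exp (-(μ * t)) * NX 1 (S.op t k)
      ≤ C * NX 1 k * Real.exp (-(δ * (t - 0))) := by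
    intro k hk t ht
    have e1 := mul_le_mul_of_nonneg_left (hdecay k hk t ht) (Real.exp_pos (-(μ * t))).le
    have e2 : Real.exp (-(δ * (t - 0))) = Real.exp (-(μ * t)) * Real.exp ((μ - δ) * t) := by
      rw [← Real.exp_add]; congr 1; ring
    rw [e2]
    linarith
  have hrate : ∀ k : X, Tendsto (fun t => C * NX 1 k * Real.exp (-(δ * (t - 0)))) atTop (𝓝 0) :=
    fun k => by simpa using (tendsto_expKernel δ 0 hδ).const_mul (C * NX 1 k)
  -- Pairing `φ'` with an orbit in the kernel of `φ` yields `e^{μ t} * ⟨φ', k⟩`, while the orbit is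
  -- `o(e^{μ t})`. So `φ'` vanishes on that kernel and is a multiple of `φ`.
  have hzero : ∀ k : X, B φ k = 0 → B φ' k = 0 := by
    intro k hk
    have e1 : ∀ t, 0 ≤ t → |B φ' k| ≤ C * NX 1 k * Real.exp (-(δ * (t - 0))) := by
      intro t ht
      have i1 := hN.pairing_01 φ' (S.op t k)
      rw [eigenvector_pairing hd hSφ' ht, htrip.norm_dual, one_mul, abs_mul,
        abs_of_pos (Real.exp_pos _)] at i1
      refine le_trans ?_ (hker k hk t ht)
      rw [Real.exp_neg, ← div_eq_inv_mul, le_div_iff₀ (Real.exp_pos _)]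
      linarith
    have e2 := ge_of_tendsto (hrate k) ((eventually_ge_atTop 0).mono e1)
    exact abs_eq_zero.1 (le_antisymm e2 (abs_nonneg _))
  have hφeq : φ' = B φ' f₁ • φ := by
    apply hB.ext_left
    intro k
    have e1 := hzero (k - B φ k • f₁) (by rw [map_sub, map_smul, smul_eq_mul, hf₁1]; ring)
    rw [map_sub, map_smul, smul_eq_mul, sub_eq_zero] at e1
    rw [e1, map_smul, smul_apply, smul_eq_mul, mul_comm]
  have hone : B φ' f₁ = 1 := by
    have e1 := htrip.norm_dual
    rw [hφeq, map_smul_eq_mul, hφ1, mul_one,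
      Real.norm_of_nonneg (hB.pairing_nonneg htrip.dual_nonneg hf₁)] at e1
    exact e1
  have hφφ : φ' = φ := by rw [hφeq, hone, one_smul]
  refine ⟨rfl, ?_, hφφ⟩
  have hpair : B φ f = 1 := by rw [← hφφ]; exact htrip.pairing
  have hk : B φ (f - f₁) = 0 := by rw [map_sub, hpair, hf₁1, sub_self]
  -- The difference is an eigenvector lying in the kernel of `φ`, where orbits decay strictly faster
  -- than `e^{μ t}`.
  have e1 : ∀ t, 0 ≤ t → NX 1 (f - f₁) ≤ C * NX 1 (f - f₁) * Real.exp (-(δ * (t - 0))) := by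
    intro t ht
    have i1 := hker _ hk t ht
    rwa [map_sub, hSf t ht, hSf₁ t ht, ← smul_sub, map_smul_eq_mul,
      Real.norm_of_nonneg (Real.exp_pos _).le, ← mul_assoc, ← Real.exp_add, neg_add_cancel,
      Real.exp_zero, one_mul] at i1
  have e2 := ge_of_tendsto (hrate (f - f₁)) ((eventually_ge_atTop 0).mono e1)
  exact sub_eq_zero.1 ((NX 1).eq_zero_of _ (le_antisymm e2 (apply_nonneg _ _)))

end Eigentriplet

end KreinRutman

/-! ### Choice of the constants and conclusion. -/

open KreinRutman in
/-- The constants `C` and `δ = lam₁ - lam₂` are chosen before the spaces, the norms and the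
semigroups: they depend only on the numerical constants of the assumptions. -/
theorem theorem6p1
    (lam lam₀ lam' C₀ C₁ C₀' T₀ T₁ : ℝ) (η : ℝ → ℝ → ℝ) (ξ Ξ : ℝ → ℝ)
    (hlam : lam < lam₀) (hC₀ : 0 < C₀) (hC₁ : 0 < C₁) (hC₀' : 1 ≤ C₀')
    (hT₀ : 0 ≤ T₀) (hT₁ : T₀ < T₁)
    (hη : ∀ ε T : ℝ, 0 < ε → T₁ ≤ T → 0 < η ε T)
    (hξ_pos : ∀ ε ∈ Set.Ioc (0 : ℝ) 1, 0 < ξ ε)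
    (hξ_mono : MonotoneOn ξ (Set.Ioc 0 1))
    (hξ_lim : Filter.Tendsto ξ (nhdsWithin 0 (Set.Ioi 0)) (nhds 0))
    (hΞ_pos : ∀ ε ∈ Set.Ioc (0 : ℝ) 1, 0 < Ξ ε)
    (hΞ_anti : AntitoneOn Ξ (Set.Ioc 0 1))
    (hΞ_lim : Filter.Tendsto Ξ (nhdsWithin 0 (Set.Ioi 0)) Filter.atTop) :
    ∃ C δ : ℝ, 1 ≤ C ∧ 0 < δ ∧
      ∀ (X : Type u) (Y : Type v)
        [NormedAddCommGroup X] [NormedSpace ℝ X] [Lattice X] [IsOrderedAddMonoid X]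
        [IsOrderedModule ℝ X] [HasSolidNorm X] [CompleteSpace X]
        [NormedAddCommGroup Y] [NormedSpace ℝ Y] [Lattice Y] [IsOrderedAddMonoid Y]
        [IsOrderedModule ℝ Y] [HasSolidNorm Y] [CompleteSpace Y]
        (B : Y →L[ℝ] X →L[ℝ] ℝ) (S : C0Semigroup X) (Sd : C0Semigroup Y)
        (NX : Fin 2 → LatticeNorm X) (NY : Fin 2 → LatticeNorm Y)
        (g : ℝ → X) (ψ : ℝ → Y),
        OrderDuality B → S.IsPositive → DualSemigroups B S Sd →
        CompatibleNorms B NX NY →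
        StronglyDissipative lam C₀ C₁ S NX →
        (HasSupereigenvector lam₀ S ∨ HasSupereigenvector lam₀ Sd) →
        BoundedDecreasingFamily g → BoundedDecreasingFamily ψ →
        DoblinHarris T₀ T₁ η B S Sd g ψ →
        Interpolation ξ Ξ B NX NY g ψ →
        (NX 1).IsBanach → GrowthBound lam' C₀' S (NX 1) →
        DualSplitting lam C₀ C₁ Sd NY →
        WeaklySeqCompactBalls B (NY 1) →
        ∃ (lam₁ : ℝ) (f₁ : X) (φ₁ : Y),
          IsEigentriplet B S Sd (NY 0) lam₁ f₁ φ₁ ∧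
          (∀ (μ : ℝ) (f : X) (φ : Y),
            IsEigentriplet B S Sd (NY 0) μ f φ → μ = lam₁ ∧ f = f₁ ∧ φ = φ₁) ∧
          ∃ lam₂ : ℝ, lam₂ = lam₁ - δ ∧ ∀ (f : X) (t : ℝ), 0 ≤ t →
            NX 1 (S.op t f - (B φ₁ f * Real.exp (lam₁ * t)) • f₁)
              ≤ C * Real.exp (lam₂ * t) * NX 1 (f - B φ₁ f • f₁) := by
  have ha : 0 < lam₀ - lam := sub_pos.2 hlam
  have hsmall : ∀ e : ℝ, 0 < e → ∃ ε ∈ Set.Ioc (0 : ℝ) 1, ξ ε ≤ e := by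
    intro e he
    have h1 : ∀ᶠ ε in nhdsWithin (0 : ℝ) (Set.Ioi 0), ξ ε < e := hξ_lim.eventually_lt_const he
    have h2 : ∀ᶠ ε in nhdsWithin (0 : ℝ) (Set.Ioi 0), ε ∈ Set.Ioc (0 : ℝ) 1 :=
      Ioc_mem_nhdsGT one_pos
    obtain ⟨ε, h3, h4⟩ := (h1.and h2).exists
    exact ⟨ε, h4, h3.le⟩
  -- First scale: it makes the Volterra kernels small and serves for the dual eigenvector and the
  -- Lyapunov estimate.
  obtain ⟨ε₀, hε₀, hξ₀⟩ := hsmall ((lam₀ - lam) / 4 / C₁) (by positivity)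
  rw [le_div_iff₀ hC₁] at hξ₀
  have hξ₀p := hξ_pos ε₀ hε₀
  have hΞ₀p := hΞ_pos ε₀ hε₀
  have hη₀ := hη ε₀ T₁ hε₀.1 le_rfl
  set K : ℝ := 2 * C₁ / (lam₀ - lam) with hK
  have hKp : 0 < K := by positivity
  -- Weak constant of the interpolation inequality after `ψ ε` has been replaced by `φ`.
  set M : ℝ → ℝ := fun ε => Ξ ε * (2 * Ξ ε * Real.exp (lam' * (T₁ - T₀)) / η ε T₁) with hM
  have hMp : 0 < M ε₀ := by simp only [hM]; positivity
  set P : ℝ := 2 * (C₀ + 1) with hP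
  have hPp : 0 < P := by positivity
  set K₂ : ℝ := 4 * C₁ * M ε₀ / (lam₀ - lam) with hK₂
  have hK₂p : 0 < K₂ := by positivity
  obtain ⟨T, hTT₁, hT, hPT⟩ : ∃ T, T₁ ≤ T ∧ 0 < T ∧
      P * Real.exp (-((lam₀ - lam) / 2 * T)) ≤ 1 / 4 := by
    have h1 := (tendsto_expKernel ((lam₀ - lam) / 2) 0 (by positivity)).const_mul P
    simp only [mul_zero, sub_zero] at h1
    have h2 := h1.eventually_lt_const (by norm_num : (0 : ℝ) < 1 / 4)
    obtain ⟨T, h3, h4⟩ := (h2.and (Filter.eventually_ge_atTop (max T₁ 1))).exists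
    exact ⟨T, (le_max_left _ _).trans h4, one_pos.trans_le ((le_max_right _ _).trans h4), h3.le⟩
  -- The threshold separating the two regimes of `harris_combination`.
  set A : ℝ := 4 * K₂ + 1 with hA
  -- Second scale, for the Doblin step: it must be small against `A` and `K₂`, which already depend
  -- on `ε₀`.
  obtain ⟨ε₁, hε₁, hξ₁⟩ := hsmall (min ((lam₀ - lam) / 4 / C₁) (1 / 4 / (K * (P * A + K₂))))
    (lt_min (by positivity) (by positivity))
  have hξ₁a : ξ ε₁ * C₁ ≤ (lam₀ - lam) / 4 := by
    have := hξ₁.trans (min_le_left _ _)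
    rwa [le_div_iff₀ hC₁] at this
  have hξ₁b : K * ξ ε₁ * (P * A + K₂) ≤ 1 / 4 := by
    have := hξ₁.trans (min_le_right _ _)
    rw [le_div_iff₀ (by positivity)] at this
    linarith
  have hξ₁p := hξ_pos ε₁ hε₁
  have hΞ₁p := hΞ_pos ε₁ hε₁
  have hη₁ := hη ε₁ T hε₁.1 hTT₁
  set c : ℝ := η ε₁ T * Real.exp (-(lam' * (T - T₀))) / (8 * K * Ξ ε₁ ^ 2) with hc
  have hcp : 0 < c := by positivity
  set d : ℝ := min (1 / 4) (c / (K₂ + 1) / 4) with hd_def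
  have hdp : 0 < d := lt_min (by norm_num) (by positivity)
  have hd4 : d ≤ 1 / 4 := min_le_left _ _
  have hdc : d ≤ c / (K₂ + 1) / 4 := min_le_right _ _
  set δ : ℝ := -(Real.log (1 - d) / T) with hδ_def
  have hδ : 0 < δ := by
    have := Real.log_neg (by linarith : 0 < 1 - d) (by linarith)
    rw [hδ_def, ← neg_div]
    exact div_pos (by linarith) hT
  set C' : ℝ := (1 + c / (K₂ + 1) * (P + K₂)) / (c / (K₂ + 1) * (1 - d)) with hC'
  refine ⟨max 1 C', δ, le_max_left _ _, hδ, ?_⟩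
  intro X Y _ _ _ _ _ _ _ _ _ _ _ _ _ _ B S Sd NX NY g ψ hB hS hd hN hdiss hsuper hg hψ hDH hint
    hBanach hgrowth hsplit hcompact
  have hSd := hd.isPositive hB hS
  obtain ⟨lam₁, φ, hlam₁, hφ, hφ1, heig⟩ := exists_dual_eigenvector hlam hB hS hd hN hdiss hsplit
    hsuper hgrowth hcompact hC₀ hC₁ hC₀' (hg.nonneg ε₀ hε₀.1) (hψ.nonneg ε₀ hε₀.1) hξ₀p hΞ₀p
    (hint.primal ε₀ hε₀) (hint.dual ε₀ hε₀) (by linarith)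
  have hlam' : lam₁ ≤ lam' := eigenvalue_le_growth hB hd hN hgrowth hφ1 heig
  have hge : ∀ ε ∈ Set.Ioc (0 : ℝ) 1, ξ ε * C₁ ≤ (lam₀ - lam) / 4 →
      1 / (2 * Ξ ε) ≤ B φ (g ε) := by
    intro ε hε hξε
    refine eigenvector_pairing_ge hlam hB hSd hN hsplit hC₀ hC₁ hlam₁ hφ hφ1 heig (hξ_pos ε hε)
      (hΞ_pos ε hε) (hint.dual ε hε) ?_
    rw [← mul_div_assoc, div_le_iff₀ ha]
    linarith
  have hinterp : ∀ ε ∈ Set.Ioc (0 : ℝ) 1, ξ ε * C₁ ≤ (lam₀ - lam) / 4 →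
      ∀ f, NX 0 f ≤ ξ ε * NX 1 f + M ε * B φ |f| := by
    intro ε hε hξε f
    have h1 := pairing_le_eigenvector_pairing hB hφ heig hT₀ hT₁ (hη ε T₁ hε.1 le_rfl)
      (hΞ_pos ε hε) hlam' (hψ.nonneg ε hε.1) (hDH.dual ε T₁ hε.1 le_rfl φ hφ) (hge ε hε hξε)
      (abs_nonneg f)
    have h2 := mul_le_mul_of_nonneg_left h1 (hΞ_pos ε hε).le
    have h3 := hint.primal ε hε f
    rw [bracketX] at h3
    simp only [hM]
    linarith
  have hlyap : ∀ f t, 0 ≤ t → Real.exp (-(lam₁ * t)) * NX 1 (S.op t f)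
      ≤ P * Real.exp (-((lam₀ - lam) / 2 * t)) * NX 1 f + K₂ * B φ |f| := fun f t ht =>
    lyapunov_estimate hlam hB hS hd hdiss hC₀ hC₁ hlam₁ hφ heig hξ₀p hMp.le (hinterp ε₀ hε₀ hξ₀)
      (by linarith) f ht
  have hlyap' : ∀ f t, 0 ≤ t → Real.exp (-(lam₁ * t)) * NX 1 (S.op t f)
      ≤ P * NX 1 f + K₂ * B φ |f| := by
    intro f t ht
    refine (hlyap f t ht).trans ?_
    have h1 : P * Real.exp (-((lam₀ - lam) / 2 * t)) ≤ P * 1 := by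
      gcongr
      exact Real.exp_le_one_iff.2 (neg_nonpos.2 (by positivity))
    have h2 := mul_le_mul_of_nonneg_right h1 (apply_nonneg (NX 1).toSeminorm f)
    linarith
  have hdecay : ∀ f, B φ f = 0 → ∀ t, 0 ≤ t →
      NX 1 (S.op t f) ≤ max 1 C' * Real.exp ((lam₁ - δ) * t) * NX 1 f := by
    intro f hf t ht
    have h1 := exp_decay_on_kernel hB hd hS hN hφ hφ1 heig hPp.le hK₂p.le
      (by positivity : 0 ≤ (lam₀ - lam) / 2) hcp hT hdp hd4 hdc hlyap hPT
      (fun f hf hfA => doblin_contraction hB hd hφ heig hT₀ (hT₁.le.trans hTT₁) hη₁ hKp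
        hξ₁p hΞ₁p hPp.le hK₂p.le (hg.nonneg ε₁ hε₁.1) hlam'
        (eigenvector_pairing_le hlam hB hSd hN hsplit hC₀ hC₁ hlam₁ hφ hφ1 heig)
        (hint.primal ε₁ hε₁) (fun f => hlyap' f T₀ hT₀) hξ₁b (hge ε₁ hε₁ hξ₁a)
        (fun f hf => hDH.primal ε₁ T hε₁.1 hTT₁ f hf) hf hfA) hf ht
    have h2 : lam₁ + Real.log (1 - d) / T = lam₁ - δ := by rw [hδ_def]; ring
    rw [h2] at h1
    refine h1.trans ?_
    have h3 : 0 ≤ NX 1 f := apply_nonneg _ _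
    gcongr
    exact le_max_right _ _
  have hgpos : 0 < B φ (g ε₀) := lt_of_lt_of_le (by positivity) (hge ε₀ hε₀ hξ₀)
  -- The vector `g ε₀`, normalized against `φ`, is the starting point of the convergent orbit.
  obtain ⟨f₁, hf₁, hf₁1, hSf₁⟩ := exists_primal_eigenvector hd hS hN hφ1 heig hBanach hgrowth hδ
    (le_max_left _ _) hdecay (h := (B φ (g ε₀))⁻¹ • g ε₀)
    (smul_nonneg (by positivity) (hg.nonneg ε₀ hε₀.1))
    (by rw [map_smul, smul_eq_mul, inv_mul_cancel₀ hgpos.ne']) ⟨_, hlyap' _⟩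
  refine ⟨lam₁, f₁, φ, ⟨S.generatorMaps_of_eigenvector hSf₁, hf₁,
    Sd.generatorMaps_of_eigenvector heig, hφ, hφ1, hf₁1⟩, ?_, lam₁ - δ, rfl, ?_⟩
  · intro μ f φ' htrip
    refine eigentriplet_unique hB hd hN hφ1 heig hδ hdecay ?_ hf₁ hf₁1 hSf₁ htrip
    intro e he
    obtain ⟨ε, hε, hξε⟩ := hsmall (min e ((lam₀ - lam) / 4 / C₁)) (lt_min he (by positivity))
    have h1 := hξε.trans (min_le_right _ _)
    rw [le_div_iff₀ hC₁] at h1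
    refine ⟨M ε, fun f => (hinterp ε hε h1 f).trans ?_⟩
    have h2 : 0 ≤ NX 1 f := apply_nonneg _ _
    gcongr
    exact hξε.trans (min_le_left _ _)
  · intro f t ht
    have h1 := hdecay (f - B φ f • f₁) (by rw [map_sub, map_smul, smul_eq_mul, hf₁1]; ring) t ht
    rwa [map_sub, map_smul, hSf₁ t ht, smul_smul] at h1
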